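/- Let $A,B,C$ be three consecutive blocks of $L_A,L_B,L_C$ qubits forming a periodic chain of $L=L_A+L_B+L_C$ sites, with Pauli matrices $\sigma^x_k,\sigma^z_k$ at site $k$ and $\sigma^z_{L+1}=\sigma^z_1$. Let $h_1,\dots,h_L\in\mathbb{R}$ be arbitrary and consider the self-dual kicked field Ising model ($J=\pi/4$, $b=-\pi/4$) with one-period evolution operator $$U=e^{-iH_K}e^{-iH_I},\qquad H_I=J\sum_{k=1}^{L}\sigma^z_k\sigma^z_{k+1}+\sum_{k=1}^{L}h_k\sigma^z_k,\qquad H_K=b\sum_{k=1}^{L}\sigma^x_k .$$ Let the initial state be a transverse-class product state $|\psi_0\rangle=\bigotimes_{k=1}^{L}\tfrac{1}{\sqrt2}\left(|{\uparrow}\rangle+e^{i\phi_k}|{\downarrow}\rangle\right)$ with $\phi_k\in[0,2\pi]$, and put $|\psi(t)\rangle=U^t|\psi_0\rangle$ for an integer $t\ge 0$. Let $\rho_{AB}=\mathrm{tr}_C|\psi(t)\rangle\langle\psi(t)|$, let $\rho_A,\rho_B$ be the reduced density matrices of $A$ and $B$, and let $\rho_{AB}^{T_B}$ be the partial transpose of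 $\rho_{AB}$ with respect to $B$, with eigenvalues $\lambda_i$ counted with multiplicity. Define the negativity, the odd entropy, the Rényi entropy and the Rényi mutual information by $$\mathcal E=\ln\mathrm{tr}\sqrt{(\rho_{AB}^{T_B})^\dagger\rho_{AB}^{T_B}},\qquad \mathcal E^{o}=-\sum_{\lambda_i>0}|\lambda_i|\ln|\lambda_i|+\sum_{\lambda_i<0}|\lambda_i|\ln|\lambda_i|,$$ $$S^{(\alpha)}_X=\tfrac{1}{1-\alpha}\ln\mathrm{tr}\,\rho_X^{\alpha},\qquad I^{(\alpha)}_{A:B}=S^{(\alpha)}_A+S^{(\alpha)}_B-S^{(\alpha)}_{AB}$$ for $\alpha\ge 0$, where $S^{(1)}_X=-\mathrm{tr}\,\rho_X\ln\rho_X$ and $\mathrm{tr}\,\rho^0$ is the rank of $\rho$. Suppose that $2t\le L_A$, $2t\le L_B$ and $2t\le L_C$. Then: 1. The nonzero singular values of $\rho_{AB}^{T_B}$ all equal $2^{-3t}$, and there are exactly $2^{4t}$ of them, counted with multiplicity. 2. Counted with multiplicity, the number of positive eigenvalues of $\rho_{AB}^{T_B}$ is $N_+=\dfrac{2^{4t}+2^{3t}}{2}$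 and the number of negative eigenvalues is $N_-=\dfrac{2^{4t}-2^{3t}}{2}$. 3. $\mathcal E=t\ln 2$ and $\mathcal E^{o}=3t\ln 2$, and for every $\alpha\ge 0$ $$2\mathcal E=\tfrac23\mathcal E^{o}=I^{(\alpha)}_{A:B}=S^{(\alpha)}_A=S^{(\alpha)}_B .$$ -/

import Mathlib

open scoped Matrix ComplexConjugate

namespace KickedIsing

noncomputable section

/-- Spin configurations (computational basis labels) of `L` qubits: `0` is spin up (`σᶻ = 1`),
`1` is spin down (`σᶻ = -1`). -/
abbrev Config (L : ℕ) : Type := Fin L → Fin 2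

/-- Operators on `(ℂ²)^{⊗ L}`, written in the computational basis. -/
abbrev Op (L : ℕ) : Type := Matrix (Config L) (Config L) ℂ

def pauliX : Matrix (Fin 2) (Fin 2) ℂ := !![0, 1; 1, 0]

def pauliZ : Matrix (Fin 2) (Fin 2) ℂ := !![1, 0; 0, -1]

/-- The operator acting as `P` on site `i` and as the identity on all other sites. -/
def siteOp {L : ℕ} (i : Fin L) (P : Matrix (Fin 2) (Fin 2) ℂ) : Op L :=
  fun s r => if ∀ j, j ≠ i → s j = r j then P (s i) (r i) else 0

/-- The Ising Hamiltonian `J ∑ᵢ σᶻᵢ σᶻᵢ₊₁ + ∑ᵢ hᵢ σᶻᵢ` on the periodic chain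
(`finRotate L` sends site `i` to `i + 1` modulo `L`). -/
def isingHamiltonian {L : ℕ} (J : ℝ) (h : Fin L → ℝ) : Op L :=
  (J : ℂ) • ∑ i, siteOp i pauliZ * siteOp (finRotate L i) pauliZ
    + ∑ i, (h i : ℂ) • siteOp i pauliZ

/-- The kick Hamiltonian `b ∑ᵢ σˣᵢ`. -/
def kickHamiltonian (L : ℕ) (b : ℝ) : Op L :=
  ∑ i : Fin L, (b : ℂ) • siteOp i pauliX

/-- The one-period Floquet operator `U = e^{-i H_K} e^{-i H_I}`. -/
def floquet {L : ℕ} (J b : ℝ) (h : Fin L → ℝ) : Op L :=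
  NormedSpace.exp (-Complex.I • kickHamiltonian L b)
    * NormedSpace.exp (-Complex.I • isingHamiltonian J h)

/-- The product state `⊗ₖ (cos(θₖ/2) |↑⟩ + e^{iφₖ} sin(θₖ/2) |↓⟩)`. -/
def productState {L : ℕ} (θ φ : Fin L → ℝ) : Config L → ℂ :=
  fun s => ∏ k, if s k = 0 then (Real.cos (θ k / 2) : ℂ)
    else Complex.exp (Complex.I * φ k) * (Real.sin (θ k / 2) : ℂ)

/-- The transverse class: product states with all polar angles `π/2` and arbitrary phases. -/
def transverseClass (L : ℕ) : Set (Config L → ℂ) :=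
  {ψ | ∃ φ : Fin L → ℝ, (∀ k, φ k ∈ Set.Icc 0 (2 * Real.pi)) ∧
    ψ = productState (fun _ => Real.pi / 2) φ}

/-- The state after `t` periods. -/
def evolved {L : ℕ} (J b : ℝ) (h : Fin L → ℝ) (ψ₀ : Config L → ℂ) (t : ℕ) : Config L → ℂ :=
  (floquet J b h ^ t) *ᵥ ψ₀

section Tripartition

variable {LA LB LC : ℕ}

/-- Concatenation of configurations of the three consecutive blocks `A`, `B`, `C`. -/
def join (a : Config LA) (b : Config LB) (c : Config LC) : Config (LA + LB + LC) :=
  Fin.append (Fin.append a b) c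

/-- The reduced density matrix `ρ_AB = tr_C |ψ⟩⟨ψ|`. -/
def rhoAB (ψ : Config (LA + LB + LC) → ℂ) :
    Matrix (Config LA × Config LB) (Config LA × Config LB) ℂ :=
  fun p q => ∑ c : Config LC, ψ (join p.1 p.2 c) * conj (ψ (join q.1 q.2 c))

/-- The reduced density matrix `ρ_A = tr_{BC} |ψ⟩⟨ψ|`. -/
def rhoA (ψ : Config (LA + LB + LC) → ℂ) : Op LA :=
  fun a a' => ∑ b : Config LB, rhoAB ψ (a, b) (a', b)

/-- The reduced density matrix `ρ_B = tr_{AC} |ψ⟩⟨ψ|`. -/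
def rhoB (ψ : Config (LA + LB + LC) → ℂ) : Op LB :=
  fun b b' => ∑ a : Config LA, rhoAB ψ (a, b) (a, b')

end Tripartition

/-- Partial transposition on the second tensor factor. -/
def partialTranspose {m n : Type*} (X : Matrix (m × n) (m × n) ℂ) :
    Matrix (m × n) (m × n) ℂ :=
  fun p q => X (p.1, q.2) (q.1, p.2)

theorem rhoAB_isHermitian {LA LB LC : ℕ} (ψ : Config (LA + LB + LC) → ℂ) :
    (rhoAB ψ).IsHermitian := by
  ext p q
  simp [rhoAB, Matrix.conjTranspose_apply, mul_comm]

theorem partialTranspose_isHermitian {m n : Type*} {X : Matrix (m × n) (m × n) ℂ}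
    (hX : X.IsHermitian) : (partialTranspose X).IsHermitian := by
  ext p q
  exact hX.apply (p.1, q.2) (q.1, p.2)

section Entropies

variable {n : Type*} [Fintype n] [DecidableEq n]

/-- The logarithmic negativity `ln tr √(X† X)` of a partially transposed density matrix `X`. -/
def negativity (X : Matrix n n ℂ) : ℝ :=
  Real.log (cfc Real.sqrt (Xᴴ * X)).trace.re

/-- The Rényi entropy `(1 - α)⁻¹ ln tr ρ^α` of a density matrix, with the von Neumann entropy
`- tr (ρ ln ρ)` as its value at `α = 1`. The power `ρ^α` is taken on the support of `ρ`, which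
matters only at `α = 0`, where `tr ρ^0` is the rank. -/
def renyiEntropy (α : ℝ) (ρ : Matrix n n ℂ) : ℝ :=
  if α = 1 then -(cfc (fun x : ℝ => x * Real.log x) ρ).trace.re
  else 1 / (1 - α) * Real.log (cfc (fun x : ℝ => if x = 0 then 0 else x ^ α) ρ).trace.re

/-- Number of positive eigenvalues, with multiplicity. -/
def numPos {X : Matrix n n ℂ} (hX : X.IsHermitian) : ℕ :=
  (Finset.univ.filter fun i => 0 < hX.eigenvalues i).card

/-- Number of negative eigenvalues, with multiplicity. -/
def numNeg {X : Matrix n n ℂ} (hX : X.IsHermitian) : ℕ :=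
  (Finset.univ.filter fun i => hX.eigenvalues i < 0).card

/-- The odd entropy `- ∑_{λᵢ > 0} |λᵢ| ln |λᵢ| + ∑_{λᵢ < 0} |λᵢ| ln |λᵢ|`. -/
def oddEntropy {X : Matrix n n ℂ} (hX : X.IsHermitian) : ℝ :=
  -(∑ i with 0 < hX.eigenvalues i, |hX.eigenvalues i| * Real.log |hX.eigenvalues i|)
    + ∑ i with hX.eigenvalues i < 0, |hX.eigenvalues i| * Real.log |hX.eigenvalues i|

end Entropies

/-- The Rényi mutual information `S_A + S_B - S_AB`. -/
def renyiMutualInfo {LA LB LC : ℕ} (α : ℝ) (ψ : Config (LA + LB + LC) → ℂ) : ℝ :=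
  renyiEntropy α (rhoA ψ) + renyiEntropy α (rhoB ψ) - renyiEntropy α (rhoAB ψ)

/-- The partially transposed reduced density matrix `ρ_AB^{T_B}`. -/
def rhoABTB {LA LB LC : ℕ} (ψ : Config (LA + LB + LC) → ℂ) :
    Matrix (Config LA × Config LB) (Config LA × Config LB) ℂ :=
  partialTranspose (rhoAB ψ)

theorem rhoABTB_isHermitian {LA LB LC : ℕ} (ψ : Config (LA + LB + LC) → ℂ) :
    (rhoABTB ψ).IsHermitian :=
  partialTranspose_isHermitian (rhoAB_isHermitian ψ)

end

end KickedIsing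

/-!
At the self-dual point the matrix elements of the kick and of the Ising coupling agree up to
single-site phases and constants: both are the sign `(-1)^(σσ')`. The evolved state is therefore a
sum over spin histories on a space-time lattice, each of weight a product of phases on the sites
and of signs on the bonds (`evolved_eq_sum`), in which space and time play the same role.

Cutting the ring into the blocks `A`, `B`, `C` gives for each block an amplitude which depends on
the final configuration of the block and on the histories of its first and last sites; across each
cut the two adjacent histories, elements of a space of dimension `2 ^ t`, are coupled by a Hadamard
matrix. The heart of the matter is that the amplitude of a block of length at least `2 t` is a
multiple of an isometry from the histories of its ends to the final configurations
(`blockAmplitude_isometry`). In the overlap of two block amplitudes, sum over one history and over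
its difference `d` to the other one. For fixed `d` the sum factorises over the sites, because the
bond sign is a bicharacter, and at every free site where `d` vanishes it contributes `0` unless the
values of `d` at the neighbouring sites add up to `0`. As `d` vanishes at the final time, this
local rule makes it vanish in a triangle below the final configuration, and since this triangle
reaches the initial time, sweeping sideways then makes it vanish everywhere (`lightCone`).

Hence the state is, up to local isometries, a triangle of three maximally entangled pairs of local
dimension `2 ^ t`, one for each cut (`evolved_eq_triangle`). Every reduced density matrix is then a
multiple of a projection of rank `2 ^ (2 * t)`, and the partial transpose of `ρ_AB` is a multiple of
a swap operator embedded by a local isometry (`spectrum_of_triangle`). All constants follow from the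
normalisation of the state. The spectral quantities are read off from the identity `X³ = μ² X` and
from the traces of `X` and `X²`, which determine the numbers of positive and negative eigenvalues
(`numPos_numNeg_of_traces`).
-/

namespace KickedIsing

/-! ### Hermitian matrices with spectrum in `{0, μ, -μ}` -/

section Spectral

variable {n : Type*} [Fintype n] [DecidableEq n] {X : Matrix n n ℂ}

theorem trace_cfc_re (hX : X.IsHermitian) (f : ℝ → ℝ) :
    (cfc f X).trace.re = ∑ i, f (hX.eigenvalues i) := by
  rw [hX.cfc_eq f, Matrix.IsHermitian.cfc, Unitary.conjStarAlgAut_apply, Matrix.trace_mul_comm,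
    ← mul_assoc]
  simp [Matrix.trace]

theorem trace_re_eq_sum_eigenvalues (hX : X.IsHermitian) :
    X.trace.re = ∑ i, hX.eigenvalues i := by
  rw [hX.trace_eq_sum_eigenvalues]; simp

theorem trace_sq_re_eq_sum_eigenvalues (hX : X.IsHermitian) :
    (X * X).trace.re = ∑ i, hX.eigenvalues i ^ 2 := by
  rw [← trace_cfc_re hX (fun x => x ^ 2), cfc_pow_id (R := ℝ) X 2 (ha := hX.isSelfAdjoint), pow_two]

theorem eigenvalue_cube (hX : X.IsHermitian) {μ : ℝ} (h3 : X * X * X = ((μ : ℂ) ^ 2) • X) (i : n) :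
    hX.eigenvalues i ^ 3 = μ ^ 2 * hX.eigenvalues i := by
  have h1 := hX.mulVec_eigenvectorBasis i
  set v : n → ℂ := WithLp.ofLp (hX.eigenvectorBasis i) with hv
  have hv0 : v ≠ 0 := by
    intro h0
    have := hX.eigenvectorBasis.orthonormal.ne_zero i
    apply this
    ext j
    simpa using congrFun h0 j
  have h4 := congrArg (fun M : Matrix n n ℂ => M *ᵥ v) h3
  simp only [← Matrix.mulVec_mulVec, Matrix.smul_mulVec, h1, Matrix.mulVec_smul] at h4
  obtain ⟨j, hj⟩ := Function.ne_iff.mp hv0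
  have h5 := congrFun h4 j
  simp only [Pi.smul_apply, Complex.real_smul, smul_eq_mul, Pi.zero_apply] at h5 hj
  have h6 : ((hX.eigenvalues i ^ 3 : ℝ) : ℂ) = ((μ ^ 2 * hX.eigenvalues i : ℝ) : ℂ) := by
    apply mul_right_cancel₀ hj
    push_cast
    linear_combination h5
  exact_mod_cast h6

theorem eigenvalue_trichotomy (hX : X.IsHermitian) {μ : ℝ}
    (h3 : X * X * X = ((μ : ℂ) ^ 2) • X) (i : n) :
    hX.eigenvalues i = 0 ∨ hX.eigenvalues i = μ ∨ hX.eigenvalues i = -μ := by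
  have h := eigenvalue_cube hX h3 i
  have h' : hX.eigenvalues i * ((hX.eigenvalues i - μ) * (hX.eigenvalues i + μ)) = 0 := by
    linear_combination h
  rcases mul_eq_zero.mp h' with h0 | h0
  · exact Or.inl h0
  · rcases mul_eq_zero.mp h0 with h1 | h1
    · exact Or.inr (Or.inl (by linarith))
    · exact Or.inr (Or.inr (by linarith))

theorem sum_pos_eigenvalues (hX : X.IsHermitian) {μ : ℝ} (hμ : 0 < μ)
    (h3 : X * X * X = ((μ : ℂ) ^ 2) • X) (f : ℝ → ℝ) :
    ∑ i with 0 < hX.eigenvalues i, f (hX.eigenvalues i) = numPos hX * f μ := by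
  rw [numPos, ← nsmul_eq_mul]
  refine Finset.sum_eq_card_nsmul fun i hi => ?_
  have hi' := (Finset.mem_filter.mp hi).2
  rcases eigenvalue_trichotomy hX h3 i with h | h | h
  · linarith
  · rw [h]
  · linarith

theorem sum_neg_eigenvalues (hX : X.IsHermitian) {μ : ℝ} (hμ : 0 < μ)
    (h3 : X * X * X = ((μ : ℂ) ^ 2) • X) (f : ℝ → ℝ) :
    ∑ i with hX.eigenvalues i < 0, f (hX.eigenvalues i) = numNeg hX * f (-μ) := by
  rw [numNeg, ← nsmul_eq_mul]
  refine Finset.sum_eq_card_nsmul fun i hi => ?_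
  have hi' := (Finset.mem_filter.mp hi).2
  rcases eigenvalue_trichotomy hX h3 i with h | h | h
  · linarith
  · linarith
  · rw [h]

theorem sum_eigenvalues (hX : X.IsHermitian) {μ : ℝ} (hμ : 0 < μ)
    (h3 : X * X * X = ((μ : ℂ) ^ 2) • X) {f : ℝ → ℝ} (hf : f 0 = 0) :
    ∑ i, f (hX.eigenvalues i) = numPos hX * f μ + numNeg hX * f (-μ) := by
  rw [← sum_pos_eigenvalues hX hμ h3, ← sum_neg_eigenvalues hX hμ h3, Finset.sum_filter,
    Finset.sum_filter, ← Finset.sum_add_distrib]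
  refine Finset.sum_congr rfl fun i _ => ?_
  rcases lt_trichotomy (hX.eigenvalues i) 0 with h | h | h
  · simp [h, h.le]
  · simp [h, hf]
  · simp [h, h.le]

theorem trace_cfc_of_cube (hX : X.IsHermitian) {μ : ℝ} (hμ : 0 < μ)
    (h3 : X * X * X = ((μ : ℂ) ^ 2) • X) {f : ℝ → ℝ} (hf : f 0 = 0) :
    (cfc f X).trace.re = numPos hX * f μ + numNeg hX * f (-μ) := by
  rw [trace_cfc_re hX, sum_eigenvalues hX hμ h3 hf]

/-- The traces of `X` and `X²` determine the numbers of positive and negative eigenvalues. -/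
theorem numPos_numNeg_of_traces (hX : X.IsHermitian) {μ m N : ℝ} (hμ : 0 < μ)
    (h3 : X * X * X = ((μ : ℂ) ^ 2) • X) (h1 : X.trace.re = μ * m)
    (h2 : (X * X).trace.re = μ ^ 2 * N) :
    (numPos hX : ℝ) = (N + m) / 2 ∧ (numNeg hX : ℝ) = (N - m) / 2 := by
  rw [trace_re_eq_sum_eigenvalues hX, sum_eigenvalues hX hμ h3 (f := fun x => x) rfl] at h1
  rw [trace_sq_re_eq_sum_eigenvalues hX,
    sum_eigenvalues hX hμ h3 (f := fun x => x ^ 2) (by simp)] at h2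
  have h1' : (numPos hX : ℝ) - numNeg hX = m := by
    apply mul_left_cancel₀ hμ.ne'; linarith
  have h2' : (numPos hX : ℝ) + numNeg hX = N := by
    apply mul_left_cancel₀ (pow_pos hμ 2).ne'; linarith
  constructor <;> linarith

theorem negativity_eq (hX : X.IsHermitian) {μ : ℝ} (hμ : 0 < μ)
    (h3 : X * X * X = ((μ : ℂ) ^ 2) • X) :
    negativity X = Real.log ((numPos hX + numNeg hX) * μ) := by
  have h : cfc Real.sqrt (Xᴴ * X) = cfc (fun x : ℝ => |x|) X := by
    rw [hX.eq, ← pow_two, ← cfc_comp_pow Real.sqrt 2 X (ha := hX.isSelfAdjoint)]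
    simp only [Real.sqrt_sq_eq_abs]
  rw [negativity, h, trace_cfc_of_cube hX hμ h3 abs_zero, abs_neg, abs_of_pos hμ,
    add_mul]

theorem oddEntropy_eq (hX : X.IsHermitian) {μ : ℝ} (hμ : 0 < μ)
    (h3 : X * X * X = ((μ : ℂ) ^ 2) • X) :
    oddEntropy hX = -((numPos hX - numNeg hX) * μ * Real.log μ) := by
  rw [oddEntropy, sum_pos_eigenvalues hX hμ h3 (fun x => |x| * Real.log |x|),
    sum_neg_eigenvalues hX hμ h3 (fun x => |x| * Real.log |x|), abs_neg, abs_of_pos hμ]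
  ring

/-- A density matrix proportional to a projection has the single nonzero eigenvalue `μ`, of
multiplicity `1 / μ`, so that its Rényi entropies do not depend on the index. -/
theorem renyiEntropy_of_mul_self (hX : X.IsHermitian) {μ : ℝ} (hμ : 0 < μ)
    (h2 : X * X = (μ : ℂ) • X) (h1 : X.trace = 1) (α : ℝ) :
    renyiEntropy α X = -Real.log μ := by
  have h3 : X * X * X = ((μ : ℂ) ^ 2) • X := by
    rw [h2, Matrix.smul_mul, h2, smul_smul, pow_two]
  have hn : (numPos hX : ℝ) = 1 / μ ∧ (numNeg hX : ℝ) = 0 := by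
    have := numPos_numNeg_of_traces hX (m := 1 / μ) (N := 1 / μ) hμ h3
      (by rw [h1]; field_simp; simp) (by rw [h2, Matrix.trace_smul, h1]; simp; field_simp)
    constructor
    · rw [this.1]; ring
    · rw [this.2]; ring
  rw [renyiEntropy]
  split_ifs with hα
  · rw [trace_cfc_of_cube hX hμ h3 (by simp), hn.1, hn.2]
    field_simp
    ring
  · rw [trace_cfc_of_cube hX hμ h3 (by simp), hn.1, hn.2, if_neg hμ.ne', zero_mul,
      add_zero, Real.log_mul (by positivity) (by positivity), Real.log_rpow hμ, one_div μ,
      Real.log_inv]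
    have : 1 - α ≠ 0 := sub_ne_zero.mpr (Ne.symm hα)
    field_simp
    ring

theorem card_support_singularValues_eq (hX : X.IsHermitian) :
    (Matrix.toEuclideanLin X).singularValues.support.card = numPos hX + numNeg hX := by
  have h : Module.finrank ℂ (Matrix.toEuclideanLin X).range = X.rank :=
    (Matrix.rank_eq_finrank_range_toLin X (EuclideanSpace.basisFun n ℂ).toBasis
      (EuclideanSpace.basisFun n ℂ).toBasis).symm
  rw [LinearMap.card_support_singularValues, h, hX.rank_eq_card_non_zero_eigs, numPos, numNeg,
    ← Finset.card_union_of_disjoint, Fintype.card_subtype]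
  · congr 1
    ext i
    simpa [or_comm] using ne_iff_lt_or_gt (a := hX.eigenvalues i) (b := 0)
  · rw [Finset.disjoint_filter]
    intro i _ h1 h2
    linarith

theorem singularValues_eq (hX : X.IsHermitian) {μ : ℝ} (hμ : 0 < μ)
    (h3 : X * X * X = ((μ : ℂ) ^ 2) • X) (i : ℕ)
    (hi : (Matrix.toEuclideanLin X).singularValues i ≠ 0) :
    (Matrix.toEuclideanLin X).singularValues i = μ := by
  set T := Matrix.toEuclideanLin X with hT
  have hlt : i < Module.finrank ℂ (EuclideanSpace ℂ n) := by
    by_contra hcon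
    exact hi (T.singularValues_of_finrank_le (not_lt.mp hcon))
  obtain ⟨v, hv⟩ := (T.hasEigenvalue_adjoint_comp_self_sq_singularValues hlt).exists_hasEigenvector
  have hadj : LinearMap.adjoint T = T := by
    rw [hT, ← Matrix.toEuclideanLin_conjTranspose_eq_adjoint, hX.eq]
  have hT3 : ∀ w, T (T (T w)) = ((μ : ℂ) ^ 2) • T w := by
    intro w
    have := congrArg (fun M => Matrix.toEuclideanLin M w) h3
    simpa [hT, Matrix.toLpLin_apply, Matrix.mulVec_mulVec, Matrix.smul_mulVec] using this
  have h4 := hv.apply_eq_smul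
  rw [LinearMap.comp_apply, hadj] at h4
  have h5 : T (T (T (T v))) = ((μ : ℂ) ^ 2) • T (T v) := by rw [hT3]
  rw [h4, map_smul, map_smul, h4, smul_smul, smul_smul] at h5
  have h6 := smul_left_injective ℂ hv.2 h5
  have h7 : (T.singularValues i) ^ 2 * (T.singularValues i) ^ 2
      = μ ^ 2 * (T.singularValues i) ^ 2 := by
    have h6' : (((T.singularValues i) ^ 2 * (T.singularValues i) ^ 2 : ℝ) : ℂ)
      = ((μ ^ 2 * (T.singularValues i) ^ 2 : ℝ) : ℂ) := by
      push_cast; exact h6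
    exact_mod_cast h6'
  have h8 := mul_right_cancel₀ (pow_ne_zero 2 hi) h7
  exact (pow_left_inj₀ (T.singularValues_nonneg i) hμ.le two_ne_zero).mp h8

end Spectral

/-! ### Light cones on the space-time lattice -/

section LightCone

variable {G : Type*} [AddCommGroup G] {t ℓ : ℕ} {D : ℕ → ℕ → G}

/-- The values on the rows `0` and `1` propagate through the local rule `hstep` into the triangle
below them: vanishing of `D` on these rows forces it to vanish on row `τ`, except on its first and
last `τ - 1` sites. -/
theorem lightCone_inner (h0 : ∀ k < ℓ, D 0 k = 0) (h1 : ∀ k < ℓ, D 1 k = 0)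
    (hstep : ∀ τ k, τ + 1 ≤ t → k + 2 < ℓ → D (τ + 1) (k + 1) = 0 →
      D τ (k + 1) + D (τ + 2) (k + 1) + (D (τ + 1) k + D (τ + 1) (k + 2)) = 0) :
    ∀ τ k, τ ≤ t → τ ≤ k + 1 → k + τ ≤ ℓ → k < ℓ → D τ k = 0 := by
  intro τ
  induction τ using Nat.strong_induction_on with
  | _ τ ih =>
    intro k ht hk hl hkl
    match τ, k with
    | 0, k => exact h0 k hkl
    | 1, k => exact h1 k hkl
    | τ + 2, 0 => omega
    | τ + 2, k + 1 =>
      have h := hstep τ k (by omega) (by omega)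
        (ih (τ + 1) (by omega) (k + 1) (by omega) (by omega) (by omega) (by omega))
      rwa [ih τ (by omega) (k + 1) (by omega) (by omega) (by omega) (by omega),
        ih (τ + 1) (by omega) k (by omega) (by omega) (by omega) (by omega),
        ih (τ + 1) (by omega) (k + 2) (by omega) (by omega) (by omega) (by omega), zero_add,
        add_zero, add_zero] at h

/-- The local rule `hstep` sweeps the triangle of `lightCone_inner` sideways: each step extends the
region where `D` vanishes by one diagonal to the left, starting from the last row, below which `D`
vanishes. Here `j` counts the diagonals and `i` the rows from below. -/
theorem lightCone_left (hℓ : 2 * t ≤ ℓ) (h0 : ∀ k < ℓ, D 0 k = 0) (h1 : ∀ k < ℓ, D 1 k = 0)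
    (htop : ∀ k < ℓ, D (t + 1) k = 0)
    (hstep : ∀ τ k, τ + 1 ≤ t → k + 2 < ℓ → D (τ + 1) (k + 1) = 0 →
      D τ (k + 1) + D (τ + 2) (k + 1) + (D (τ + 1) k + D (τ + 1) (k + 2)) = 0)
    (j : ℕ) : ∀ i τ, τ + i = t + 1 → ∀ k, τ ≤ k + 1 + j → (τ ≤ t → k + τ ≤ ℓ) → k < ℓ →
      D τ k = 0 := by
  induction j with
  | zero =>
    intro i τ hi k hk hl hkl
    by_cases hτ : τ ≤ t
    · exact lightCone_inner h0 h1 hstep τ k hτ hk (hl hτ) hkl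
    · obtain rfl : τ = t + 1 := by omega
      exact htop k hkl
  | succ j ihj =>
    intro i
    induction i with
    | zero =>
      rintro τ rfl k - - hkl
      exact htop k hkl
    | succ i ihi =>
      intro τ hi k hk hl hkl
      by_cases hτ : τ ≤ k + 1 + j
      · exact ihj _ τ hi k hτ hl hkl
      · obtain ⟨τ, rfl⟩ : ∃ σ, τ = σ + 1 := ⟨τ - 1, by omega⟩
        have h := hstep τ k (by omega) (by omega)
          (ihj _ (τ + 1) hi (k + 1) (by omega) (by omega) (by omega))
        rwa [ihj (i + 2) τ (by omega) (k + 1) (by omega) (by omega) (by omega),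
          ihi (τ + 2) (by omega) (k + 1) (by omega) (by omega) (by omega),
          ihj _ (τ + 1) hi (k + 2) (by omega) (by omega) (by omega), zero_add, add_zero,
          zero_add] at h

/-- If `2 t ≤ ℓ`, a solution of the local rule `hstep` on `t` rows of length `ℓ` which vanishes on
row `0` just above, on row `t + 1` just below, and on row `1`, vanishes identically. The rule is
imposed only at interior sites, and only where `D` itself vanishes. -/
theorem lightCone (hℓ : 2 * t ≤ ℓ) (h0 : ∀ k < ℓ, D 0 k = 0) (h1 : ∀ k < ℓ, D 1 k = 0)
    (htop : ∀ k < ℓ, D (t + 1) k = 0)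
    (hstep : ∀ τ k, τ + 1 ≤ t → k + 2 < ℓ → D (τ + 1) (k + 1) = 0 →
      D τ (k + 1) + D (τ + 2) (k + 1) + (D (τ + 1) k + D (τ + 1) (k + 2)) = 0)
    {τ k : ℕ} (hτ : τ ≤ t) (hk : k < ℓ) : D τ k = 0 := by
  by_cases hkτ : k + τ ≤ ℓ
  · exact lightCone_left hℓ h0 h1 htop hstep t (t + 1 - τ) τ (by omega) k (by omega)
      (fun _ => hkτ) hk
  -- the right end follows from the left end by reflection
  · have h := lightCone_left (D := fun τ k => D τ (ℓ - 1 - k)) hℓ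
      (fun k hk => h0 _ (by omega)) (fun k hk => h1 _ (by omega)) (fun k hk => htop _ (by omega))
      (fun τ k hτ hk hD => by
        have e1 : ℓ - 1 - (k + 1) = ℓ - 3 - k + 1 := by omega
        have e2 : ℓ - 1 - k = ℓ - 3 - k + 2 := by omega
        have e3 : ℓ - 1 - (k + 2) = ℓ - 3 - k := by omega
        simp only [e1, e2, e3] at hD ⊢
        rw [add_comm (D (τ + 1) (ℓ - 3 - k + 2))]
        exact hstep τ (ℓ - 3 - k) hτ (by omega) hD)
      t (t + 1 - τ) τ (by omega) (ℓ - 1 - k) (by omega) (fun _ => by omega) (by omega)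
    rwa [show ℓ - 1 - (ℓ - 1 - k) = k by omega] at h

end LightCone

/-! ### Signs of spin histories -/

noncomputable section

/-- The sign `(-1)^(ab)`, the weight of a bond of the space-time lattice up to single-site phases.
It is a bicharacter of `Fin 2`, and `bondSign 1 σ` is the eigenvalue of `σᶻ`. -/
def bondSign (a b : Fin 2) : ℂ := if a = 1 ∧ b = 1 then -1 else 1

theorem bondSign_zero_right (a : Fin 2) : bondSign a 0 = 1 := by simp [bondSign]

theorem bondSign_zero_left (a : Fin 2) : bondSign 0 a = 1 := by simp [bondSign]

theorem bondSign_comm (a b : Fin 2) : bondSign a b = bondSign b a := by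
  simp [bondSign, and_comm]

theorem bondSign_add_right (a b c : Fin 2) :
    bondSign a (b + c) = bondSign a b * bondSign a c := by
  fin_cases a <;> fin_cases b <;> fin_cases c <;> simp [bondSign]

theorem bondSign_add_left (a b c : Fin 2) :
    bondSign (a + b) c = bondSign a c * bondSign b c := by
  simp only [bondSign_comm _ c, bondSign_add_right]

theorem bondSign_mul_self (a b : Fin 2) : bondSign a b * bondSign a b = 1 := by
  fin_cases a <;> fin_cases b <;> simp [bondSign]

theorem conj_bondSign (a b : Fin 2) : conj (bondSign a b) = bondSign a b := by
  unfold bondSign; split_ifs <;> simp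

theorem sum_bondSign (b : Fin 2) : ∑ a, bondSign a b = if b = 0 then 2 else 0 := by
  fin_cases b <;> norm_num [bondSign]

/-- The spin at position `i`, extended by `0` beyond the end of the chain. As `bondSign` is `1` when
one of its arguments is `0`, this extension introduces no additional bonds. -/
def spin {L : ℕ} (x : Config L) (i : ℕ) : Fin 2 := if h : i < L then x ⟨i, h⟩ else 0

@[simp] theorem spin_coe {L : ℕ} (x : Config L) (i : Fin L) : spin x i = x i := by simp [spin]

theorem spin_of_le {L : ℕ} (x : Config L) {i : ℕ} (h : L ≤ i) : spin x i = 0 := by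
  simp [spin, h]

theorem spin_add {L : ℕ} (x y : Config L) (i : ℕ) : spin (x + y) i = spin x i + spin y i := by
  unfold spin; split_ifs <;> simp

/-- The product of the bond signs along an open chain. The last factor of the product is `1`. -/
def chainSign {L : ℕ} (x : Config L) : ℂ :=
  ∏ i ∈ Finset.range L, bondSign (spin x i) (spin x (i + 1))

theorem chainSign_mul_self {L : ℕ} (x : Config L) : chainSign x * chainSign x = 1 := by
  simp [chainSign, ← Finset.prod_mul_distrib, bondSign_mul_self]

theorem conj_chainSign {L : ℕ} (x : Config L) : conj (chainSign x) = chainSign x := by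
  simp [chainSign, conj_bondSign]

/-- The spin to the left of position `i`, extended by `0` at the beginning of the chain. -/
def leftSpin {L : ℕ} (x : Config L) : ℕ → Fin 2
  | 0 => 0
  | i + 1 => spin x i

theorem chainSign_add {L : ℕ} (x d : Config L) :
    chainSign (x + d)
      = chainSign x * chainSign d * ∏ k, bondSign (x k) (leftSpin d k + spin d (k + 1)) := by
  have h : ∏ i ∈ Finset.range L, bondSign (spin d i) (spin x (i + 1))
      = ∏ i ∈ Finset.range L, bondSign (spin x i) (leftSpin d i) := by
    have e1 := Finset.prod_range_succ' (fun i => bondSign (spin x i) (leftSpin d i)) L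
    rw [Finset.prod_range_succ, spin_of_le x le_rfl, bondSign_zero_left, mul_one, leftSpin,
      bondSign_zero_right, mul_one] at e1
    rw [e1]
    exact Finset.prod_congr rfl fun i _ => bondSign_comm _ _
  have h' : ∏ k, bondSign (x k) (leftSpin d k + spin d (k + 1))
      = ∏ i ∈ Finset.range L, bondSign (spin x i) (leftSpin d i + spin d (i + 1)) := by
    rw [Finset.prod_range]
    simp
  rw [h']
  simp only [chainSign, spin_add, bondSign_add_left, bondSign_add_right, Finset.prod_mul_distrib,
    h]
  ring

/-- The product of the bond signs between two configurations at successive times. -/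
def kickSign {L : ℕ} (x y : Config L) : ℂ := ∏ k, bondSign (x k) (y k)

theorem kickSign_zero_right {L : ℕ} (x : Config L) : kickSign x 0 = 1 := by
  simp [kickSign, bondSign_zero_right]

theorem kickSign_comm {L : ℕ} (x y : Config L) : kickSign x y = kickSign y x := by
  simp [kickSign, bondSign_comm]

theorem kickSign_add_left {L : ℕ} (x y z : Config L) :
    kickSign (x + y) z = kickSign x z * kickSign y z := by
  simp [kickSign, bondSign_add_left, Finset.prod_mul_distrib]

theorem kickSign_add_right {L : ℕ} (x y z : Config L) :
    kickSign x (y + z) = kickSign x y * kickSign x z := by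
  simp [kickSign, bondSign_add_right, Finset.prod_mul_distrib]

theorem kickSign_mul_self {L : ℕ} (x y : Config L) : kickSign x y * kickSign x y = 1 := by
  simp [kickSign, ← Finset.prod_mul_distrib, bondSign_mul_self]

theorem conj_kickSign {L : ℕ} (x y : Config L) : conj (kickSign x y) = kickSign x y := by
  simp [kickSign, conj_bondSign]

/-- A spin history: configurations at `t + 1` successive times, in reverse order, so that row `0` is
the configuration at the final time `t` and row `t` the one at time `0`. -/
abbrev History (t L : ℕ) : Type := Fin (t + 1) → Config L

/-- The product of all bond signs of a history of an open chain. There are vertical bonds between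
successive rows, and horizontal bonds in all rows except row `0`, as the coupling acts before the
kick. -/
def bonds {t L : ℕ} (s : History t L) : ℂ :=
  ∏ τ : Fin t, kickSign (s τ.castSucc) (s τ.succ) * chainSign (s τ.succ)

theorem bonds_mul_self {t L : ℕ} (s : History t L) : bonds s * bonds s = 1 := by
  rw [bonds, ← Finset.prod_mul_distrib]
  refine Finset.prod_eq_one fun τ _ => ?_
  rw [mul_mul_mul_comm, kickSign_mul_self, chainSign_mul_self, one_mul]

theorem conj_bonds {t L : ℕ} (s : History t L) : conj (bonds s) = bonds s := by
  simp [bonds, conj_kickSign, conj_chainSign]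

/-- Row `τ` of a history, extended by zero. -/
def row {t L : ℕ} (s : History t L) (τ : ℕ) : Config L := if h : τ < t + 1 then s ⟨τ, h⟩ else 0

@[simp] theorem row_coe {t L : ℕ} (s : History t L) (τ : Fin (t + 1)) : row s τ = s τ :=
  dif_pos τ.isLt

/-- The sum of the spins at the neighbours of the site `(τ, k)`, along the bonds of `bonds`. -/
def nbrSum {t L : ℕ} (d : History t L) : ℕ → ℕ → Fin 2
  | 0, k => spin (row d 1) k
  | τ + 1, k => spin (row d τ) k + spin (row d (τ + 2)) k
      + (leftSpin (row d (τ + 1)) k + spin (row d (τ + 1)) (k + 1))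

/-- Since the bond sign is a bicharacter, shifting a history by `d` multiplies its sign by a
character, which is a product over the sites. -/
theorem bonds_add {t L : ℕ} (s d : History t L) :
    bonds (s + d)
      = bonds s * bonds d * ∏ τ : Fin (t + 1), ∏ k, bondSign (s τ k) (nbrSum d τ k) := by
  have e1 : ∀ τ : Fin (t + 1), ∏ k : Fin L, bondSign (s τ k) (spin (row d (τ + 1)) k)
      = kickSign (s τ) (row d (τ + 1)) := by
    intro τ; simp [kickSign]
  have h1 : ∏ τ : Fin (t + 1), kickSign (s τ) (row d (τ + 1))
      = ∏ τ : Fin t, kickSign (s τ.castSucc) (d τ.succ) := by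
    rw [Fin.prod_univ_castSucc]
    have : row d (t + 1) = 0 := by simp [row]
    rw [Fin.val_last, this, kickSign_zero_right, mul_one]
    refine Finset.prod_congr rfl fun τ _ => ?_
    rw [← row_coe d τ.succ, Fin.val_castSucc, Fin.val_succ]
  have h2 : ∏ τ : Fin (t + 1), ∏ k, bondSign (s τ k) (nbrSum d τ k)
      = (∏ τ : Fin (t + 1), kickSign (s τ) (row d (τ + 1)))
        * ∏ τ : Fin t, (kickSign (s τ.succ) (d τ.castSucc)
          * ∏ k, bondSign (s τ.succ k) (leftSpin (d τ.succ) k + spin (d τ.succ) (k + 1))) := by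
    rw [Fin.prod_univ_succ, Fin.prod_univ_succ (fun τ : Fin (t + 1) => kickSign (s τ) _),
      mul_assoc, ← Finset.prod_mul_distrib]
    congr 1
    · simp [nbrSum, kickSign]
    · refine Finset.prod_congr rfl fun τ _ => ?_
      rw [← row_coe d τ.succ, ← row_coe d τ.castSucc, Fin.val_castSucc, Fin.val_succ]
      simp only [nbrSum, bondSign_add_right, Finset.prod_mul_distrib, kickSign, spin_coe]
      ring
  rw [h2, h1, bonds, bonds, bonds, ← Finset.prod_mul_distrib, ← Finset.prod_mul_distrib,
    ← Finset.prod_mul_distrib]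
  refine Finset.prod_congr rfl fun τ _ => ?_
  rw [Pi.add_apply, Pi.add_apply, kickSign_add_left, kickSign_add_right, kickSign_add_right,
    chainSign_add, kickSign_comm (d τ.castSucc) (s τ.succ)]
  ring

end

/-! ### Block amplitudes are isometries -/

noncomputable section

variable {t ℓ : ℕ}

/-- The weight of a history of an open chain, for given single-site weights `f`. -/
def weight (f : Fin (t + 1) → Fin ℓ → Fin 2 → ℂ) (s : History t ℓ) : ℂ :=
  (∏ τ, ∏ k, f τ k (s τ k)) * bonds s

/-- The spin at the first site follows the history `e.1` and the one at the last site the history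
`e.2`, in all rows except row `0`. -/
def HasEnds (e : Config t × Config t) (s : History t ℓ) : Prop :=
  ∀ τ : Fin t, spin (s τ.succ) 0 = e.1 τ ∧ spin (s τ.succ) (ℓ - 1) = e.2 τ

/-- The condition which `HasEnds e` imposes on the spin `σ` at the site `(τ, k)`. -/
def EndsAt (e : Config t × Config t) (τ : Fin (t + 1)) (k : Fin ℓ) (σ : Fin 2) : Prop :=
  ∀ j : Fin t, τ = j.succ → ((k : ℕ) = 0 → σ = e.1 j) ∧ ((k : ℕ) + 1 = ℓ → σ = e.2 j)

open Classical in
/-- The amplitude of the final configuration `a` of a block, as a function of the histories of its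
two end sites: the sum of the weights over all histories with these ends. -/
def blockAmplitude (f : Fin (t + 1) → Fin ℓ → Fin 2 → ℂ) :
    Matrix (Config ℓ) (Config t × Config t) ℂ :=
  fun a e => ∑ y : Fin t → Config ℓ,
    if HasEnds e (Fin.cons a y : History t ℓ) then weight f (Fin.cons a y) else 0

theorem HasEnds.unique {e e' : Config t × Config t} {s : History t ℓ} (h : HasEnds e s)
    (h' : HasEnds e' s) : e = e' :=
  Prod.ext (funext fun τ => (h τ).1.symm.trans (h' τ).1)
    (funext fun τ => (h τ).2.symm.trans (h' τ).2)

theorem hasEnds_iff (hℓ : 2 * t ≤ ℓ) (e : Config t × Config t) (s : History t ℓ) :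
    HasEnds e s ↔ ∀ τ k, EndsAt e τ k (s τ k) := by
  constructor
  · rintro h τ k j rfl
    refine ⟨fun hk => ?_, fun hk => ?_⟩
    · rw [← (h j).1, ← hk, spin_coe]
    · rw [← (h j).2, ← Nat.eq_sub_of_add_eq hk, spin_coe]
  · intro h j
    have hj := j.isLt
    have h0 := (h j.succ ⟨0, by omega⟩ j rfl).1 rfl
    have h1 := (h j.succ ⟨ℓ - 1, by omega⟩ j rfl).2 (by simp; omega)
    rw [← h0, ← h1]
    exact ⟨spin_coe _ ⟨0, _⟩, spin_coe _ ⟨ℓ - 1, _⟩⟩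

theorem sum_cons {M : Type*} [AddCommMonoid M] {L : ℕ} (g : History t L → M) :
    ∑ s, g s = ∑ a : Config L, ∑ y : Fin t → Config L, g (Fin.cons a y) := by
  rw [← Fintype.sum_prod_type', ← (Fin.consEquiv (fun _ => Config L)).sum_comp]
  rfl

open Classical in
/-- Pairs of histories with the same final configuration, parametrised by the first one and by
their difference `d`. -/
theorem sum_pairs {M : Type*} [AddCommMonoid M] {L : ℕ} (g : History t L → History t L → M) :
    ∑ a : Config L, ∑ y : Fin t → Config L, ∑ y' : Fin t → Config L,
        g (Fin.cons a y) (Fin.cons a y')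
      = ∑ d : History t L, if d 0 = 0 then ∑ s, g s (s + d) else 0 := by
  have hc : ∀ (a : Config L) (y z : Fin t → Config L),
      (Fin.cons a y + Fin.cons 0 z : History t L) = Fin.cons a (y + z) := by
    intro a y z
    funext τ
    refine Fin.cases ?_ (fun j => ?_) τ <;> simp
  rw [sum_cons (fun d : History t L => if d 0 = 0 then ∑ s, g s (s + d) else 0)]
  refine Eq.trans ?_
    (Finset.sum_eq_single (0 : Config L) (fun d₀ _ hd₀ => by simp [hd₀]) (by simp)).symm
  simp only [Fin.cons_zero, if_true, sum_cons (fun s => g s _), hc]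
  conv_rhs => rw [Finset.sum_comm]
  refine Finset.sum_congr rfl fun a _ => ?_
  conv_rhs => rw [Finset.sum_comm]
  refine Finset.sum_congr rfl fun y _ => ?_
  exact (Equiv.sum_comp (Equiv.addLeft y) fun y' => g (Fin.cons a y) (Fin.cons a y')).symm

theorem sum_history_prod (g : Fin (t + 1) → Fin ℓ → Fin 2 → ℂ) :
    ∑ s : History t ℓ, ∏ τ, ∏ k, g τ k (s τ k) = ∏ τ, ∏ k, ∑ σ, g τ k σ := by
  simp only [Fintype.prod_sum]

open Classical in
/-- The contribution of the spin `σ` at the site `(τ, k)` to the overlap of the block amplitudes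
with ends `e` and `e'`, where `d` is the difference of the two histories. -/
def siteOverlap (f : Fin (t + 1) → Fin ℓ → Fin 2 → ℂ) (e e' : Config t × Config t)
    (d : History t ℓ) (τ : Fin (t + 1)) (k : Fin ℓ) (σ : Fin 2) : ℂ :=
  (if EndsAt e τ k σ then conj (f τ k σ) else 0)
    * (if EndsAt e' τ k (σ + d τ k) then f τ k (σ + d τ k) else 0)
    * bondSign σ (nbrSum d τ k)

open Classical in
theorem ite_hasEnds_weight (hℓ : 2 * t ≤ ℓ) (f : Fin (t + 1) → Fin ℓ → Fin 2 → ℂ)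
    (e : Config t × Config t) (s : History t ℓ) :
    (if HasEnds e s then weight f s else 0)
      = (∏ τ, ∏ k, if EndsAt e τ k (s τ k) then f τ k (s τ k) else 0) * bonds s := by
  simp only [Finset.prod_ite_zero, Finset.mem_univ, true_imp_iff, ← hasEnds_iff hℓ, ite_mul,
    zero_mul, weight]

open Classical in
/-- For a fixed difference of the two histories the overlap factorises over the sites. -/
theorem sum_overlap (hℓ : 2 * t ≤ ℓ) (f : Fin (t + 1) → Fin ℓ → Fin 2 → ℂ)
    (e e' : Config t × Config t) (d : History t ℓ) :
    ∑ s : History t ℓ, conj (if HasEnds e s then weight f s else 0)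
        * (if HasEnds e' (s + d) then weight f (s + d) else 0)
      = bonds d * ∏ τ, ∏ k, ∑ σ, siteOverlap f e e' d τ k σ := by
  rw [← sum_history_prod, Finset.mul_sum]
  refine Finset.sum_congr rfl fun s _ => ?_
  rw [ite_hasEnds_weight hℓ, ite_hasEnds_weight hℓ, map_mul, conj_bonds, bonds_add, map_prod]
  simp only [siteOverlap, Finset.prod_mul_distrib, map_prod, apply_ite (starRingEnd ℂ), map_zero,
    Pi.add_apply]
  linear_combination (∏ τ, ∏ k, if EndsAt e τ k (s τ k) then conj (f τ k (s τ k)) else 0)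
    * (∏ τ, ∏ k, if EndsAt e' τ k (s τ k + d τ k) then f τ k (s τ k + d τ k) else 0)
    * bonds d * (∏ τ : Fin (t + 1), ∏ k, bondSign (s τ k) (nbrSum d τ k)) * bonds_mul_self s

/-- At a site without boundary condition where the two histories agree, the phases cancel and the
sum over the common spin is a character sum, which vanishes unless the differences at the neighbouring
sites add up to `0`. -/
theorem nbrSum_eq_zero_of_free {f : Fin (t + 1) → Fin ℓ → Fin 2 → ℂ}
    (hf : ∀ τ k σ, ‖f τ k σ‖ = 1) {e e' : Config t × Config t} {d : History t ℓ}
    {τ : Fin (t + 1)} {k : Fin ℓ} (hfree : ∀ e σ, EndsAt e τ k σ) (hd : d τ k = 0)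
    (h : ∑ σ, siteOverlap f e e' d τ k σ ≠ 0) : nbrSum d τ k = 0 := by
  by_contra hn
  apply h
  have : ∀ σ, siteOverlap f e e' d τ k σ = bondSign σ (nbrSum d τ k) := by
    intro σ
    rw [siteOverlap, if_pos (hfree _ _), if_pos (hfree _ _), hd, add_zero, Complex.conj_mul', hf]
    simp
  rw [Finset.sum_congr rfl fun σ _ => this σ, sum_bondSign, if_neg hn]

/-- Only the diagonal `d = 0` contributes to the overlap: this is where the length of the block
enters, through `lightCone`. -/
theorem history_eq_zero_of_overlap (hℓ : 2 * t ≤ ℓ) {f : Fin (t + 1) → Fin ℓ → Fin 2 → ℂ}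
    (hf : ∀ τ k σ, ‖f τ k σ‖ = 1) {e e' : Config t × Config t} {d : History t ℓ}
    (hd : d 0 = 0) (h : ∀ τ k, ∑ σ, siteOverlap f e e' d τ k σ ≠ 0) : d = 0 := by
  have hrow : ∀ (τ : Fin (t + 1)) (k : Fin ℓ), spin (row d τ) k = d τ k := by simp
  have h0 : ∀ k < ℓ, spin (row d 0) k = 0 := by
    intro k hk
    have := hrow 0 ⟨k, hk⟩
    simp only [hd, Pi.zero_apply] at this
    exact this
  have key : ∀ τ ≤ t, ∀ k < ℓ, spin (row d τ) k = 0 := by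
    intro τ hτ k hk
    refine lightCone (D := fun τ k => spin (row d τ) k) hℓ h0 ?_ ?_ ?_ hτ hk
    · intro k hk
      have := nbrSum_eq_zero_of_free hf (τ := 0) (k := ⟨k, hk⟩) (e := e) (e' := e') (d := d)
        (fun e σ j hj => absurd hj.symm (Fin.succ_ne_zero j)) (by simp [hd]) (h 0 ⟨k, hk⟩)
      exact this
    · intro k hk
      have : row d (t + 1) = 0 := by simp [row]
      simp [this, spin]
    · intro τ k hτ hk hD
      have hd' : d ⟨τ + 1, by omega⟩ ⟨k + 1, by omega⟩ = 0 := by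
        rw [← hrow]; exact hD
      exact nbrSum_eq_zero_of_free hf (τ := ⟨τ + 1, by omega⟩) (k := ⟨k + 1, by omega⟩) (e := e)
        (e' := e') (fun e σ j _ => ⟨fun hk => by simp at hk, fun hk => by simp at hk; omega⟩) hd'
        (h _ _)
  funext τ k
  rw [← hrow]
  exact key τ (by omega) k k.isLt

open Classical in
/-- The number of histories with given ends does not depend on the ends: the spins on the first and
last columns, other than in row `0`, are fixed, and all other spins are free. -/
theorem card_hasEnds (hℓ : 2 * t ≤ ℓ) (e : Config t × Config t) :
    ∑ s : History t ℓ, (if HasEnds e s then (1 : ℂ) else 0)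
      = ∏ τ : Fin (t + 1), ∏ k : Fin ℓ,
          if τ ≠ 0 ∧ ((k : ℕ) = 0 ∨ (k : ℕ) + 1 = ℓ) then 1 else 2 := by
  have h : ∀ s : History t ℓ, (if HasEnds e s then (1 : ℂ) else 0)
      = ∏ τ, ∏ k, if EndsAt e τ k (s τ k) then (1 : ℂ) else 0 := by
    intro s
    simp only [Finset.prod_ite_zero, Finset.mem_univ, true_imp_iff, ← hasEnds_iff hℓ,
      Finset.prod_const_one]
  simp only [h]
  rw [sum_history_prod (fun τ k σ => if EndsAt e τ k σ then (1 : ℂ) else 0)]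
  refine Finset.prod_congr rfl fun τ _ => Finset.prod_congr rfl fun k _ => ?_
  by_cases hb : τ ≠ 0 ∧ ((k : ℕ) = 0 ∨ (k : ℕ) + 1 = ℓ)
  · rw [if_pos hb]
    obtain ⟨j, rfl⟩ := Fin.exists_succ_eq.mpr hb.1
    have hj := j.isLt
    obtain ⟨σ₀, hσ₀⟩ : ∃ σ₀, ∀ σ, EndsAt e j.succ k σ ↔ σ = σ₀ := by
      rcases hb.2 with hk | hk
      · refine ⟨e.1 j, fun σ => ⟨fun hσ => (hσ j rfl).1 hk, fun hσ i hi => ?_⟩⟩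
        obtain rfl := Fin.succ_injective _ hi
        exact ⟨fun _ => hσ, fun hk' => by omega⟩
      · refine ⟨e.2 j, fun σ => ⟨fun hσ => (hσ j rfl).2 hk, fun hσ i hi => ?_⟩⟩
        obtain rfl := Fin.succ_injective _ hi
        exact ⟨fun hk' => by omega, fun _ => hσ⟩
    simp [hσ₀]
  · rw [if_neg hb]
    have : ∀ σ, EndsAt e τ k σ := by
      rintro σ j rfl
      simp only [not_and_or, not_or, not_not, Fin.succ_ne_zero, false_or] at hb
      exact ⟨fun hk => absurd hk hb.1, fun hk => absurd hk hb.2⟩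
    simp [this]

theorem conj_weight_mul_self {f : Fin (t + 1) → Fin ℓ → Fin 2 → ℂ} (hf : ∀ τ k σ, ‖f τ k σ‖ = 1)
    (s : History t ℓ) : conj (weight f s) * weight f s = 1 := by
  rw [weight, map_mul, mul_mul_mul_comm, conj_bonds, bonds_mul_self, mul_one, Complex.conj_mul']
  simp [hf]

/-- For a block of length at least `2 t`, the final configurations of the block resolve the
histories of its two ends perfectly: the block amplitude is a multiple of an isometry. -/
theorem blockAmplitude_isometry (hℓ : 2 * t ≤ ℓ) {f : Fin (t + 1) → Fin ℓ → Fin 2 → ℂ}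
    (hf : ∀ τ k σ, ‖f τ k σ‖ = 1) :
    ∃ c : ℝ, (blockAmplitude f)ᴴ * blockAmplitude f = (c : ℂ) • 1 := by
  classical
  refine ⟨∏ τ : Fin (t + 1), ∏ k : Fin ℓ,
          if τ ≠ 0 ∧ ((k : ℕ) = 0 ∨ (k : ℕ) + 1 = ℓ) then 1 else 2, ?_⟩
  ext e e'
  have h1 : ((blockAmplitude f)ᴴ * blockAmplitude f) e e'
      = ∑ d : History t ℓ, if d 0 = 0 then ∑ s : History t ℓ,
        conj (if HasEnds e s then weight f s else 0)
        * (if HasEnds e' (s + d) then weight f (s + d) else 0) else 0 := by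
    rw [← sum_pairs (fun s s' : History t ℓ => conj (if HasEnds e s then weight f s else 0)
      * (if HasEnds e' s' then weight f s' else 0))]
    simp only [Matrix.mul_apply, Matrix.conjTranspose_apply, blockAmplitude, ← starRingEnd_apply,
      map_sum, Finset.sum_mul_sum]
  rw [h1, Finset.sum_eq_single 0]
  · simp only [Pi.zero_apply, if_true, add_zero, Matrix.smul_apply, Matrix.one_apply]
    by_cases he : e = e'
    · subst he
      have h2 : ∀ s : History t ℓ, conj (if HasEnds e s then weight f s else 0)
          * (if HasEnds e s then weight f s else 0) = if HasEnds e s then 1 else 0 := by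
        intro s
        split_ifs
        · exact conj_weight_mul_self hf s
        · simp
      simp only [h2, card_hasEnds hℓ, if_true, smul_eq_mul, mul_one]
      simp only [Complex.ofReal_prod, apply_ite Complex.ofReal, Complex.ofReal_one,
        Complex.ofReal_ofNat]
    · rw [if_neg he, smul_zero]
      refine Finset.sum_eq_zero fun s _ => ?_
      by_cases hs : HasEnds e s
      · rw [if_neg (fun hs' => he (hs.unique hs')), mul_zero]
      · rw [if_neg hs, map_zero, zero_mul]
  · intro d _ hd
    split_ifs with hd0
    · rw [sum_overlap hℓ]
      by_contra hne
      refine hd (history_eq_zero_of_overlap hℓ hf hd0 (e := e) (e' := e') fun τ k h => hne ?_)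
      rw [Finset.prod_eq_zero (Finset.mem_univ τ) (Finset.prod_eq_zero (Finset.mem_univ k) h),
        mul_zero]
    · rfl
  · simp

end

/-! ### The self-dual Floquet operator -/

noncomputable section

variable {L : ℕ}

/-- The phase `i^a`. -/
def spinPhase (a : Fin 2) : ℂ := if a = 1 then Complex.I else 1

theorem norm_spinPhase (a : Fin 2) : ‖spinPhase a‖ = 1 := by
  unfold spinPhase; split_ifs <;> simp

theorem siteOp_pauliZ (i : Fin L) :
    siteOp i pauliZ = Matrix.diagonal fun s => bondSign 1 (s i) := by
  ext s r
  rw [Matrix.diagonal_apply, siteOp]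
  by_cases h : s = r
  · subst h
    generalize s i = σ
    fin_cases σ <;> simp [pauliZ, bondSign]
  · rw [if_neg h]
    split_ifs with h'
    · have hi : s i ≠ r i := by
        intro hi
        apply h
        funext j
        by_cases hj : j = i
        · rw [hj, hi]
        · exact h' j hj
      revert hi
      generalize s i = σ
      generalize r i = ρ
      fin_cases σ <;> fin_cases ρ <;> simp [pauliZ]
    · rfl

theorem siteOp_pauliX (i : Fin L) (s r : Config L) :
    siteOp i pauliX s r = if r = s + Pi.single i 1 then 1 else 0 := by
  have h : r = s + Pi.single i 1 ↔ (∀ j, j ≠ i → s j = r j) ∧ r i = s i + 1 := by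
    constructor
    · rintro rfl
      exact ⟨fun j hj => by simp [hj], by simp⟩
    · rintro ⟨h1, h2⟩
      funext j
      by_cases hj : j = i
      · subst hj; simp [h2]
      · simp [hj, h1 j hj]
  have h2 : ∀ σ ρ : Fin 2, pauliX σ ρ = if ρ = σ + 1 then 1 else 0 := by
    intro σ ρ
    fin_cases σ <;> fin_cases ρ <;> simp [pauliX]
  simp only [siteOp, h, h2, ite_and]

/-- The unnormalised Hadamard matrix on `L` qubits. -/
def hadamard (L : ℕ) : Op L := fun x y => kickSign x y

theorem sum_config_prod (g : Fin L → Fin 2 → ℂ) :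
    ∑ x : Config L, ∏ k, g k (x k) = ∏ k, ∑ σ, g k σ := by
  rw [Fintype.prod_sum]

theorem hadamard_mul_self (L : ℕ) : hadamard L * hadamard L = (2 : ℂ) ^ L • 1 := by
  ext x z
  simp only [Matrix.mul_apply, hadamard, kickSign, ← Finset.prod_mul_distrib, Matrix.smul_apply,
    Matrix.one_apply]
  rw [sum_config_prod (fun k σ => bondSign (x k) σ * bondSign σ (z k))]
  have h : ∀ a b : Fin 2, ∑ σ, bondSign a σ * bondSign σ b = if a = b then 2 else 0 := by
    intro a b
    fin_cases a <;> fin_cases b <;> norm_num [bondSign]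
  simp [h, Finset.prod_ite_zero, ← funext_iff]

theorem hadamard_inv (L : ℕ) : (hadamard L)⁻¹ = ((2 : ℂ) ^ L)⁻¹ • hadamard L := by
  apply Matrix.inv_eq_right_inv
  rw [Matrix.mul_smul, hadamard_mul_self, smul_smul, inv_mul_cancel₀ (pow_ne_zero _ two_ne_zero),
    one_smul]

theorem isUnit_hadamard (L : ℕ) : IsUnit (hadamard L) := by
  refine IsUnit.of_mul_eq_one (((2 : ℂ) ^ L)⁻¹ • hadamard L) ?_
  rw [Matrix.mul_smul, hadamard_mul_self, smul_smul, inv_mul_cancel₀ (pow_ne_zero _ two_ne_zero),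
    one_smul]

/-- The Hadamard transform diagonalises the kick. -/
theorem kickHamiltonian_mul_hadamard (b : ℝ) :
    kickHamiltonian L b * hadamard L
      = hadamard L * Matrix.diagonal fun s => ∑ i, (b : ℂ) * bondSign 1 (s i) := by
  ext x z
  rw [Matrix.mul_diagonal, kickHamiltonian, Finset.sum_mul, Matrix.sum_apply, Finset.mul_sum]
  refine Finset.sum_congr rfl fun i _ => ?_
  rw [Matrix.smul_mul, Matrix.smul_apply, Matrix.mul_apply]
  simp only [siteOp_pauliX, ite_mul, one_mul, zero_mul, Finset.sum_ite_eq', Finset.mem_univ,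
    if_true, hadamard, kickSign_add_left, smul_eq_mul]
  have : kickSign (Pi.single i 1) z = bondSign 1 (z i) := by
    rw [kickSign, Finset.prod_eq_single i]
    · simp
    · intro j _ hj
      simp [hj, bondSign_zero_left]
    · simp
  rw [this]
  ring

theorem exp_diagonal {n : Type*} [Fintype n] [DecidableEq n] (v : n → ℂ) :
    NormedSpace.exp (Matrix.diagonal v) = Matrix.diagonal fun i => Complex.exp (v i) := by
  rw [Matrix.exp_diagonal]
  congr 1
  funext i
  rw [Pi.coe_exp, Complex.exp_eq_exp_ℂ]

theorem exp_kick_apply (b : ℝ) (x y : Config L) :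
    NormedSpace.exp (-Complex.I • kickHamiltonian L b) x y
      = ∏ k, (1 / 2 * ∑ σ, bondSign (x k) σ * Complex.exp (-Complex.I * (b * bondSign 1 σ))
          * bondSign σ (y k)) := by
  have h : -Complex.I • kickHamiltonian L b
      = hadamard L * (Matrix.diagonal fun s => -Complex.I * ∑ i, (b : ℂ) * bondSign 1 (s i))
        * (hadamard L)⁻¹ := by
    have hd : (Matrix.diagonal fun s : Config L => -Complex.I * ∑ i, (b : ℂ) * bondSign 1 (s i))
        = -Complex.I • Matrix.diagonal fun s : Config L => ∑ i, (b : ℂ) * bondSign 1 (s i) := by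
      rw [← Matrix.diagonal_smul]; rfl
    rw [hd, Matrix.mul_smul, ← kickHamiltonian_mul_hadamard, Matrix.smul_mul, mul_assoc,
      Matrix.mul_nonsing_inv _ ((Matrix.isUnit_iff_isUnit_det _).mp (isUnit_hadamard L)), mul_one]
  rw [h, Matrix.exp_conj _ _ (isUnit_hadamard L), exp_diagonal, hadamard_inv,
    Matrix.mul_smul, Matrix.smul_apply, Matrix.mul_apply, Finset.prod_mul_distrib,
    ← sum_config_prod (fun k σ => bondSign (x k) σ
      * Complex.exp (-Complex.I * (b * bondSign 1 σ)) * bondSign σ (y k))]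
  simp only [Matrix.mul_diagonal, smul_eq_mul, Finset.prod_const, Finset.card_univ,
    Fintype.card_fin, one_div, inv_pow, Finset.prod_mul_distrib]
  congr 1
  refine Finset.sum_congr rfl fun z _ => ?_
  rw [← Complex.exp_sum, Finset.mul_sum]
  rfl

theorem exp_pi_div_four : Complex.exp (Complex.I * (Real.pi / 4))
    = (Real.sqrt 2 / 2 : ℂ) * (1 + Complex.I) := by
  rw [mul_comm, Complex.exp_mul_I,
    show ((Real.pi : ℂ) / 4) = ((Real.pi / 4 : ℝ) : ℂ) by push_cast; rfl,
    ← Complex.ofReal_cos, ← Complex.ofReal_sin, Real.cos_pi_div_four, Real.sin_pi_div_four]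
  push_cast
  ring

theorem exp_neg_pi_div_four : Complex.exp (-(Complex.I * (Real.pi / 4)))
    = (Real.sqrt 2 / 2 : ℂ) * (1 - Complex.I) := by
  rw [mul_comm, ← neg_mul, Complex.exp_mul_I,
    show (-((Real.pi : ℂ) / 4)) = ((-(Real.pi / 4) : ℝ) : ℂ) by push_cast; rfl,
    ← Complex.ofReal_cos, ← Complex.ofReal_sin, Real.cos_neg, Real.sin_neg,
    Real.cos_pi_div_four, Real.sin_pi_div_four]
  push_cast
  ring

/-- The matrix element `⟨a| e^{iπσˣ/4} |b⟩`, written in the eigenbasis of `σˣ`, is up to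
single-site phases a bond sign. -/
theorem selfDual_kick (a b : Fin 2) :
    1 / 2 * ∑ σ, bondSign a σ * Complex.exp (-Complex.I * ((-(Real.pi / 4) : ℝ) * bondSign 1 σ))
          * bondSign σ b
      = (Real.sqrt 2 / 2 : ℂ) * (spinPhase a * spinPhase b * bondSign a b) := by
  have h0 : Complex.exp (-Complex.I * ((-(Real.pi / 4) : ℝ) * bondSign 1 0))
      = (Real.sqrt 2 / 2 : ℂ) * (1 + Complex.I) := by
    rw [← exp_pi_div_four, bondSign_zero_right]
    push_cast
    ring_nf
  have h1 : Complex.exp (-Complex.I * ((-(Real.pi / 4) : ℝ) * bondSign 1 1))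
      = (Real.sqrt 2 / 2 : ℂ) * (1 - Complex.I) := by
    rw [← exp_neg_pi_div_four]
    simp [bondSign]
  rw [Fin.sum_univ_two, h0, h1]
  fin_cases a <;> fin_cases b <;> simp [bondSign, spinPhase] <;> ring

/-- At the self-dual point the Ising coupling has, up to single-site phases, the same matrix
elements as the kick. -/
theorem selfDual_ising (a b : Fin 2) :
    Complex.exp (-Complex.I * ((Real.pi / 4 : ℝ) * (bondSign 1 a * bondSign 1 b)))
      = Complex.exp (-(Complex.I * (Real.pi / 4)))
        * (spinPhase a * spinPhase b * bondSign a b) := by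
  have h : Complex.exp (Complex.I * (Real.pi / 4))
      = Complex.exp (-(Complex.I * (Real.pi / 4))) * Complex.I := by
    rw [exp_pi_div_four, exp_neg_pi_div_four]
    linear_combination (Real.sqrt 2 / 2 : ℂ) * Complex.I_sq
  fin_cases a <;> fin_cases b <;> simp [bondSign, spinPhase, h]

theorem isingHamiltonian_eq_diagonal (J : ℝ) (h : Fin L → ℝ) :
    isingHamiltonian J h = Matrix.diagonal fun s =>
      (J : ℂ) * ∑ i, bondSign 1 (s i) * bondSign 1 (s (finRotate L i))
        + ∑ i, (h i : ℂ) * bondSign 1 (s i) := by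
  ext s r
  simp only [isingHamiltonian, siteOp_pauliZ, Matrix.diagonal_mul_diagonal, Matrix.add_apply,
    Matrix.smul_apply, Matrix.sum_apply, Matrix.diagonal_apply, smul_eq_mul]
  by_cases hsr : s = r <;> simp [hsr]

/-- The product of the bond signs along the periodic chain. -/
def ringSign (x : Config L) : ℂ := ∏ k, bondSign (x k) (x (finRotate L k))

theorem exp_ising (h : Fin L → ℝ) :
    NormedSpace.exp (-Complex.I • isingHamiltonian (Real.pi / 4) h) = Matrix.diagonal fun s =>
      Complex.exp (-(Complex.I * (Real.pi / 4))) ^ L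
        * ((∏ k, spinPhase (s k) ^ 2 * Complex.exp (-Complex.I * (h k * bondSign 1 (s k))))
          * ringSign s) := by
  rw [isingHamiltonian_eq_diagonal, ← Matrix.diagonal_smul, exp_diagonal]
  congr 1
  funext s
  have hrot : ∏ k, spinPhase (s (finRotate L k)) = ∏ k, spinPhase (s k) :=
    Equiv.prod_comp (finRotate L) fun k => spinPhase (s k)
  rw [Pi.smul_apply, smul_eq_mul, mul_add, Complex.exp_add, Finset.mul_sum, Finset.mul_sum,
    Finset.mul_sum, Complex.exp_sum, Complex.exp_sum]
  simp only [selfDual_ising, Finset.prod_mul_distrib, hrot, Finset.prod_pow, ringSign,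
    Finset.prod_const, Finset.card_univ, Fintype.card_fin]
  ring

/-- The matrix elements of one period are, up to single-site phases and a constant, the product of
the vertical and horizontal bond signs. -/
theorem floquet_apply (h : Fin L → ℝ) (x y : Config L) :
    floquet (Real.pi / 4) (-(Real.pi / 4)) h x y
      = ((Real.sqrt 2 / 2 : ℂ) ^ L * Complex.exp (-(Complex.I * (Real.pi / 4))) ^ L)
        * ((∏ k, spinPhase (x k))
          * (∏ k, spinPhase (y k) ^ 3 * Complex.exp (-Complex.I * (h k * bondSign 1 (y k))))
          * (kickSign x y * ringSign y)) := by
  rw [floquet, exp_ising, Matrix.mul_diagonal, exp_kick_apply]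
  simp only [selfDual_kick, Finset.prod_mul_distrib, Finset.prod_const, Finset.card_univ,
    Fintype.card_fin, kickSign, Finset.prod_pow]
  ring

/-- The weight of a history of the periodic chain, for given single-site weights `f`. -/
def ringWeight {t : ℕ} (f : Fin (t + 1) → Fin L → Fin 2 → ℂ) (s : History t L) : ℂ :=
  (∏ τ, ∏ k, f τ k (s τ k))
    * ∏ τ : Fin t, kickSign (s τ.castSucc) (s τ.succ) * ringSign (s τ.succ)

theorem ringWeight_cons {t : ℕ} (p : Fin L → Fin 2 → ℂ) (f : Fin (t + 1) → Fin L → Fin 2 → ℂ)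
    (x : Config L) (s : History t L) :
    ringWeight (t := t + 1) (Fin.cons p f) (Fin.cons x s)
      = (∏ k, p k (x k)) * (kickSign x (s 0) * ringSign (s 0)) * ringWeight f s := by
  rw [ringWeight, ringWeight, Fin.prod_univ_succ, Fin.prod_univ_succ (fun τ : Fin (t + 1) =>
    kickSign ((Fin.cons x s : History (t + 1) L) τ.castSucc) _ * ringSign _)]
  simp only [Fin.cons_zero, Fin.cons_succ, Fin.castSucc_zero, ← Fin.succ_castSucc]
  ring

/-- The evolved state as a sum over histories, all weights of which have the same modulus. -/
theorem evolved_eq_sum (h : Fin L → ℝ) {ψ₀ : Config L → ℂ} (hψ₀ : ψ₀ ∈ transverseClass L)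
    (t : ℕ) :
    ∃ (N : ℂ) (f : Fin (t + 1) → Fin L → Fin 2 → ℂ), (∀ τ k σ, ‖f τ k σ‖ = 1) ∧
      ∀ x, evolved (Real.pi / 4) (-(Real.pi / 4)) h ψ₀ t x
        = N * ∑ y : Fin t → Config L, ringWeight f (Fin.cons x y) := by
  induction t with
  | zero =>
    obtain ⟨φ, -, rfl⟩ := hψ₀
    refine ⟨(Real.sqrt 2 / 2 : ℂ) ^ L,
      fun _ k σ => if σ = 0 then 1 else Complex.exp (Complex.I * φ k), ?_, ?_⟩
    · intro τ k σ
      dsimp only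
      split_ifs
      · simp
      · rw [mul_comm, Complex.norm_exp_ofReal_mul_I]
    · intro x
      have h1 : ∀ k : Fin L, (if x k = 0 then (Real.cos (Real.pi / 2 / 2) : ℂ)
          else Complex.exp (Complex.I * φ k) * (Real.sin (Real.pi / 2 / 2) : ℂ))
          = (Real.sqrt 2 / 2 : ℂ) * (if x k = 0 then 1 else Complex.exp (Complex.I * φ k)) := by
        intro k
        rw [show Real.pi / 2 / 2 = Real.pi / 4 by ring, Real.cos_pi_div_four,
          Real.sin_pi_div_four]
        push_cast
        split_ifs <;> ring
      simp only [evolved, pow_zero, Matrix.one_mulVec, productState, h1, Finset.prod_mul_distrib,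
        ringWeight, Finset.prod_const, Finset.card_univ, Fintype.card_fin]
      simp
  | succ t ih =>
    obtain ⟨N, f, hf, hN⟩ := ih
    refine ⟨((Real.sqrt 2 / 2 : ℂ) ^ L * Complex.exp (-(Complex.I * (Real.pi / 4))) ^ L) * N,
      Fin.cons (fun _ σ => spinPhase σ) fun τ k σ =>
        (if τ = 0 then spinPhase σ ^ 3 * Complex.exp (-Complex.I * (h k * bondSign 1 σ)) else 1)
          * f τ k σ, ?_, ?_⟩
    · have hz : ∀ (k : Fin L) (σ : Fin 2),
          ‖Complex.exp (-Complex.I * (h k * bondSign 1 σ))‖ = 1 := by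
        intro k σ
        rw [Complex.norm_exp]
        fin_cases σ <;> simp [bondSign]
      intro τ k σ
      refine Fin.cases ?_ (fun j => ?_) τ
      · simp [norm_spinPhase]
      · rw [Fin.cons_succ]
        rw [norm_mul, hf, mul_one]
        split_ifs
        · rw [norm_mul, norm_pow, norm_spinPhase, hz, one_pow, one_mul]
        · exact norm_one
    · intro x
      have hs : ∀ s : History t L, ringWeight (fun τ k σ =>
          (if τ = 0 then spinPhase σ ^ 3 * Complex.exp (-Complex.I * (h k * bondSign 1 σ)) else 1)
            * f τ k σ) s
          = (∏ k, spinPhase (s 0 k) ^ 3 * Complex.exp (-Complex.I * (h k * bondSign 1 (s 0 k))))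
            * ringWeight f s := by
        intro s
        simp only [ringWeight, Finset.prod_mul_distrib, Fin.prod_univ_succ (n := t), if_true,
          Fin.succ_ne_zero, if_false, Finset.prod_const_one]
        ring
      have hev : evolved (Real.pi / 4) (-(Real.pi / 4)) h ψ₀ (t + 1) x
          = ∑ z, floquet (Real.pi / 4) (-(Real.pi / 4)) h x z
            * evolved (Real.pi / 4) (-(Real.pi / 4)) h ψ₀ t z := by
        rw [evolved, pow_succ', ← Matrix.mulVec_mulVec]
        rfl
      rw [hev, sum_cons (fun s : History t L => ringWeight (t := t + 1) _ (Fin.cons x s)),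
        Finset.mul_sum]
      refine Finset.sum_congr rfl fun z _ => ?_
      simp only [ringWeight_cons, hs, Fin.cons_zero]
      rw [hN, floquet_apply, ← Finset.mul_sum, ← Finset.mul_sum]
      ring

/-! ### Unitarity -/

theorem exp_neg_I_smul_conjTranspose_mul_self {n : Type*} [Fintype n] [DecidableEq n]
    {H : Matrix n n ℂ} (hH : H.IsHermitian) :
    (NormedSpace.exp (-Complex.I • H))ᴴ * NormedSpace.exp (-Complex.I • H) = 1 := by
  have h : (-Complex.I • H)ᴴ = -(-Complex.I • H) := by
    rw [Matrix.conjTranspose_smul, hH.eq]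
    simp
  rw [← Matrix.exp_conjTranspose, h, Matrix.exp_neg]
  exact Matrix.nonsing_inv_mul _ ((Matrix.isUnit_iff_isUnit_det _).mp (Matrix.isUnit_exp _))

theorem isingHamiltonian_isHermitian (J : ℝ) (h : Fin L → ℝ) :
    (isingHamiltonian J h).IsHermitian := by
  rw [isingHamiltonian_eq_diagonal, Matrix.IsHermitian, Matrix.diagonal_conjTranspose]
  congr 1
  funext s
  simp [← starRingEnd_apply, conj_bondSign]

theorem kickHamiltonian_isHermitian (b : ℝ) : (kickHamiltonian L b).IsHermitian := by
  ext x y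
  have h : ∀ i, y = x + Pi.single i 1 ↔ x = y + Pi.single i 1 := by
    have h2 : ∀ i, (Pi.single i 1 + Pi.single i 1 : Config L) = 0 := by
      intro i
      rw [← Pi.single_add]
      exact Pi.single_zero i
    intro i
    constructor <;> rintro rfl <;> rw [add_assoc, h2, add_zero]
  simp [kickHamiltonian, Matrix.conjTranspose_apply, Matrix.sum_apply, siteOp_pauliX, h,
    apply_ite (starRingEnd ℂ)]

theorem floquet_conjTranspose_mul_self (J b : ℝ) (h : Fin L → ℝ) :
    (floquet J b h)ᴴ * floquet J b h = 1 := by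
  rw [floquet, Matrix.conjTranspose_mul, mul_assoc, ← mul_assoc _ _ (NormedSpace.exp _),
    exp_neg_I_smul_conjTranspose_mul_self (kickHamiltonian_isHermitian b), one_mul,
    exp_neg_I_smul_conjTranspose_mul_self (isingHamiltonian_isHermitian J h)]

theorem sum_conj_mul_evolved (J b : ℝ) (h : Fin L → ℝ) {ψ₀ : Config L → ℂ}
    (hψ₀ : ψ₀ ∈ transverseClass L) (t : ℕ) :
    ∑ x, evolved J b h ψ₀ t x * conj (evolved J b h ψ₀ t x) = 1 := by
  induction t with
  | zero =>
    obtain ⟨φ, -, rfl⟩ := hψ₀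
    simp only [evolved, pow_zero, Matrix.one_mulVec, productState, map_prod,
      ← Finset.prod_mul_distrib]
    rw [sum_config_prod (fun k σ => (if σ = 0 then (Real.cos (Real.pi / 2 / 2) : ℂ)
      else Complex.exp (Complex.I * φ k) * (Real.sin (Real.pi / 2 / 2) : ℂ))
      * conj (if σ = 0 then (Real.cos (Real.pi / 2 / 2) : ℂ)
      else Complex.exp (Complex.I * φ k) * (Real.sin (Real.pi / 2 / 2) : ℂ)))]
    refine Finset.prod_eq_one fun k _ => ?_
    rw [Fin.sum_univ_two]
    simp only [Complex.mul_conj', if_true, one_ne_zero, if_false, norm_mul]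
    rw [mul_comm Complex.I, Complex.norm_exp_ofReal_mul_I, Complex.norm_real, Complex.norm_real]
    norm_cast
    simp
  | succ t ih =>
    have hev : evolved J b h ψ₀ (t + 1) = floquet J b h *ᵥ evolved J b h ψ₀ t := by
      rw [evolved, pow_succ', ← Matrix.mulVec_mulVec]
      rfl
    have hdot : ∀ v : Config L → ℂ, ∑ x, v x * conj (v x) = v ⬝ᵥ star v := fun v => rfl
    rw [hdot] at ih ⊢
    rw [hev, Matrix.star_mulVec, dotProduct_comm, Matrix.dotProduct_mulVec, Matrix.vecMul_vecMul,
      floquet_conjTranspose_mul_self, Matrix.vecMul_one, dotProduct_comm, ih]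

end

/-! ### Cutting the ring into blocks -/

noncomputable section

variable {LA LB LC t : ℕ}

theorem spin_append_of_lt (a : Config LA) (b : Config LB) {i : ℕ} (h : i < LA) :
    spin (Fin.append a b : Config (LA + LB)) i = spin a i := by
  rw [spin, dif_pos (by omega), spin, dif_pos h]
  exact Fin.append_left a b ⟨i, h⟩

theorem spin_append_add (a : Config LA) (b : Config LB) (i : ℕ) :
    spin (Fin.append a b : Config (LA + LB)) (LA + i) = spin b i := by
  by_cases h : i < LB
  · rw [spin, dif_pos (by omega), spin, dif_pos h]
    exact Fin.append_right a b ⟨i, h⟩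
  · rw [spin_of_le _ (by omega), spin_of_le _ (by omega)]

theorem chainSign_append (a : Config LA) (b : Config LB) :
    chainSign (Fin.append a b : Config (LA + LB))
      = chainSign a * chainSign b * bondSign (spin a (LA - 1)) (spin b 0) := by
  have hA : ∏ i ∈ Finset.range LA, bondSign (spin (Fin.append a b : Config (LA + LB)) i)
      (spin (Fin.append a b : Config (LA + LB)) (i + 1))
      = chainSign a * bondSign (spin a (LA - 1)) (spin b 0) := by
    rcases LA with - | n
    · simp [chainSign, spin, bondSign_zero_left]
    · rw [chainSign, Finset.prod_range_succ, Finset.prod_range_succ, spin_of_le a le_rfl,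
        bondSign_zero_right, mul_one, Nat.add_sub_cancel, spin_append_of_lt _ _ n.lt_succ_self,
        ← spin_append_add a b 0]
      congr 1
      refine Finset.prod_congr rfl fun i hi => ?_
      have := Finset.mem_range.mp hi
      rw [spin_append_of_lt _ _ (by omega), spin_append_of_lt _ _ (by omega)]
  rw [chainSign, Finset.prod_range_add, hA]
  simp only [add_assoc, spin_append_add]
  rw [chainSign, chainSign]
  ring

theorem ringSign_eq_chainSign_mul {L : ℕ} (hL : 0 < L) (x : Config L) :
    ringSign x = chainSign x * bondSign (spin x (L - 1)) (spin x 0) := by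
  obtain ⟨n, rfl⟩ : ∃ n, L = n + 1 := ⟨L - 1, by omega⟩
  rw [ringSign, chainSign, Finset.prod_range_succ, spin_of_le x le_rfl, bondSign_zero_right,
    mul_one, Fin.prod_univ_castSucc, finRotate_last, Finset.prod_range, Nat.add_sub_cancel]
  congr 1
  · refine Finset.prod_congr rfl fun i _ => ?_
    rw [finRotate_apply, Fin.coeSucc_eq_succ, ← spin_coe x i.succ, ← spin_coe x i.castSucc]
    simp
  · rw [← spin_coe x (Fin.last n), ← spin_coe x 0]
    simp

theorem ringSign_join (hA : 0 < LA) (hB : 0 < LB) (hC : 0 < LC) (a : Config LA) (b : Config LB)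
    (c : Config LC) :
    ringSign (join a b c) = chainSign a * chainSign b * chainSign c
      * (bondSign (spin a (LA - 1)) (spin b 0) * bondSign (spin b (LB - 1)) (spin c 0)
        * bondSign (spin c (LC - 1)) (spin a 0)) := by
  have h1 : spin (Fin.append a b : Config (LA + LB)) (LA + LB - 1) = spin b (LB - 1) := by
    rw [Nat.add_sub_assoc hB, spin_append_add]
  have h2 : spin (join a b c) (LA + LB + LC - 1) = spin c (LC - 1) := by
    rw [Nat.add_sub_assoc hC, join, spin_append_add]
  have h3 : spin (join a b c) 0 = spin a 0 := by
    rw [join, spin_append_of_lt _ _ (by omega), spin_append_of_lt _ _ hA]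
  rw [ringSign_eq_chainSign_mul (by omega), h2, h3, join, chainSign_append, chainSign_append, h1]
  ring

theorem prod_join {M : Type*} [CommMonoid M] (g : Fin (LA + LB + LC) → M) :
    ∏ k, g k = (∏ k : Fin LA, g (Fin.castAdd LC (Fin.castAdd LB k)))
      * (∏ k : Fin LB, g (Fin.castAdd LC (Fin.natAdd LA k)))
      * ∏ k : Fin LC, g (Fin.natAdd (LA + LB) k) := by
  rw [Fin.prod_univ_add, Fin.prod_univ_add]

theorem join_left (a : Config LA) (b : Config LB) (c : Config LC) (k : Fin LA) :
    join a b c (Fin.castAdd LC (Fin.castAdd LB k)) = a k := by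
  rw [join, Fin.append_left, Fin.append_left]

theorem join_mid (a : Config LA) (b : Config LB) (c : Config LC) (k : Fin LB) :
    join a b c (Fin.castAdd LC (Fin.natAdd LA k)) = b k := by
  rw [join, Fin.append_left, Fin.append_right]

theorem join_right (a : Config LA) (b : Config LB) (c : Config LC) (k : Fin LC) :
    join a b c (Fin.natAdd (LA + LB) k) = c k := by
  rw [join, Fin.append_right]

theorem kickSign_join (a a' : Config LA) (b b' : Config LB) (c c' : Config LC) :
    kickSign (join a b c) (join a' b' c') = kickSign a a' * kickSign b b' * kickSign c c' := by
  simp only [kickSign, prod_join, join_left, join_mid, join_right]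

/-- Configurations of the periodic chain as triples of configurations of the blocks. -/
def joinEquiv (LA LB LC : ℕ) :
    (Config LA × Config LB) × Config LC ≃ Config (LA + LB + LC) :=
  ((Fin.appendEquiv LA LB).prodCongr (Equiv.refl _)).trans (Fin.appendEquiv (LA + LB) LC)

theorem joinEquiv_apply (p : (Config LA × Config LB) × Config LC) :
    joinEquiv LA LB LC p = join p.1.1 p.1.2 p.2 := rfl

theorem sum_join {M : Type*} [AddCommMonoid M] (g : Config (LA + LB + LC) → M) :
    ∑ x, g x = ∑ a : Config LA, ∑ b : Config LB, ∑ c : Config LC, g (join a b c) := by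
  rw [← (joinEquiv LA LB LC).sum_comp]
  simp only [Fintype.sum_prod_type, joinEquiv_apply]

theorem sum_join_history {M : Type*} [AddCommMonoid M]
    (g : (Fin t → Config (LA + LB + LC)) → M) :
    ∑ y, g y = ∑ yA : Fin t → Config LA, ∑ yB : Fin t → Config LB, ∑ yC : Fin t → Config LC,
      g (fun τ => join (yA τ) (yB τ) (yC τ)) := by
  let e : ((Fin t → Config LA) × (Fin t → Config LB)) × (Fin t → Config LC)
      ≃ (Fin t → Config (LA + LB + LC)) :=
    (((Equiv.arrowProdEquivProdArrow (Fin t) _ _).symm.prodCongr (Equiv.refl _)).trans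
      (Equiv.arrowProdEquivProdArrow (Fin t) _ _).symm).trans
      (Equiv.arrowCongr (Equiv.refl _) (joinEquiv LA LB LC))
  rw [← e.sum_comp]
  simp only [Fintype.sum_prod_type]
  rfl

/-- The history of the first site. -/
def firstColumn {ℓ : ℕ} (y : Fin t → Config ℓ) : Config t := fun τ => spin (y τ) 0

/-- The history of the last site. -/
def lastColumn {ℓ : ℕ} (y : Fin t → Config ℓ) : Config t := fun τ => spin (y τ) (ℓ - 1)

theorem sum_blockAmplitude_mul {ℓ : ℕ} (f : Fin (t + 1) → Fin ℓ → Fin 2 → ℂ) (a : Config ℓ)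
    (g : Config t → Config t → ℂ) :
    ∑ y : Fin t → Config ℓ, weight f (Fin.cons a y) * g (firstColumn y) (lastColumn y)
      = ∑ l, ∑ r, blockAmplitude f a (l, r) * g l r := by
  classical
  have hends : ∀ (y : Fin t → Config ℓ) (l r : Config t),
      HasEnds (l, r) (Fin.cons a y : History t ℓ) ↔ l = firstColumn y ∧ r = lastColumn y := by
    intro y l r
    simp only [HasEnds, Fin.cons_succ, forall_and, funext_iff, firstColumn, lastColumn, eq_comm]
  simp only [blockAmplitude, hends, Finset.sum_mul, ite_mul, zero_mul, ite_and]
  simp only [Finset.sum_comm (s := (Finset.univ : Finset (Config t)))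
    (t := (Finset.univ : Finset (Fin t → Config ℓ)))]
  refine Finset.sum_congr rfl fun y _ => ?_
  rw [Finset.sum_eq_single (firstColumn y) (fun l _ hl => by simp [hl]) (by simp),
    Finset.sum_eq_single (lastColumn y) (fun l _ hl => by simp [hl]) (by simp)]
  simp

/-- Only the horizontal bonds across the three cuts couple the histories of the blocks. -/
theorem ringWeight_join (hA : 2 * t ≤ LA) (hB : 2 * t ≤ LB) (hC : 2 * t ≤ LC)
    (f : Fin (t + 1) → Fin (LA + LB + LC) → Fin 2 → ℂ) (a : Config LA) (b : Config LB)
    (c : Config LC) (yA : Fin t → Config LA) (yB : Fin t → Config LB) (yC : Fin t → Config LC) :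
    ringWeight f (Fin.cons (join a b c) fun τ => join (yA τ) (yB τ) (yC τ))
      = weight (fun τ k => f τ (Fin.castAdd LC (Fin.castAdd LB k))) (Fin.cons a yA)
        * weight (fun τ k => f τ (Fin.castAdd LC (Fin.natAdd LA k))) (Fin.cons b yB)
        * weight (fun τ k => f τ (Fin.natAdd (LA + LB) k)) (Fin.cons c yC)
        * (kickSign (lastColumn yA) (firstColumn yB) * kickSign (lastColumn yB) (firstColumn yC)
          * kickSign (lastColumn yC) (firstColumn yA)) := by
  have hcons : (Fin.cons (join a b c) fun τ => join (yA τ) (yB τ) (yC τ) :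
      History t (LA + LB + LC)) = fun τ => join ((Fin.cons a yA : History t LA) τ)
        ((Fin.cons b yB : History t LB) τ) ((Fin.cons c yC : History t LC) τ) := by
    funext τ
    refine Fin.cases ?_ (fun j => ?_) τ <;> simp
  have hring : ∀ τ : Fin t, ringSign (join (yA τ) (yB τ) (yC τ))
      = chainSign (yA τ) * chainSign (yB τ) * chainSign (yC τ)
        * (bondSign (lastColumn yA τ) (firstColumn yB τ)
          * bondSign (lastColumn yB τ) (firstColumn yC τ)
          * bondSign (lastColumn yC τ) (firstColumn yA τ)) := by
    intro τ
    -- for `t = 0` the blocks may be empty, but then there is no row to consider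
    have := τ.isLt
    exact ringSign_join (by omega) (by omega) (by omega) _ _ _
  rw [hcons, ringWeight]
  simp only [prod_join, join_left, join_mid, join_right, Fin.cons_succ, kickSign_join, hring,
    weight, bonds, Finset.prod_mul_distrib]
  have hk : ∀ u v : Config t, kickSign u v = ∏ τ, bondSign (u τ) (v τ) := fun _ _ => rfl
  simp only [hk]
  ring

theorem sum_ringWeight_join (hA : 2 * t ≤ LA) (hB : 2 * t ≤ LB) (hC : 2 * t ≤ LC)
    (f : Fin (t + 1) → Fin (LA + LB + LC) → Fin 2 → ℂ) (a : Config LA) (b : Config LB)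
    (c : Config LC) :
    ∑ y : Fin t → Config (LA + LB + LC), ringWeight f (Fin.cons (join a b c) y)
      = ∑ lA, ∑ rA, blockAmplitude (fun τ k => f τ (Fin.castAdd LC (Fin.castAdd LB k))) a (lA, rA)
        * ∑ lB, ∑ rB, blockAmplitude (fun τ k => f τ (Fin.castAdd LC (Fin.natAdd LA k))) b (lB, rB)
        * ∑ lC, ∑ rC, blockAmplitude (fun τ k => f τ (Fin.natAdd (LA + LB) k)) c (lC, rC)
        * (kickSign rA lB * kickSign rB lC * kickSign rC lA) := by
  rw [sum_join_history]
  simp only [ringWeight_join hA hB hC, ← sum_blockAmplitude_mul, mul_assoc]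
  simp only [Finset.mul_sum]

end

/-! ### Triangle states -/

noncomputable section

open scoped Kronecker

section Triangle

variable {l m n Q : Type*}
  {A : Matrix m (Q × Q) ℂ} {B : Matrix n (Q × Q) ℂ} {C : Matrix l (Q × Q) ℂ} {α β γ : ℂ}

theorem sum_conj_mul_of_isometry {m k : Type*} [Fintype m] [Fintype k] [DecidableEq k]
    {V : Matrix m k ℂ} {δ : ℂ} (hV : Vᴴ * V = δ • 1) (u v : k → ℂ) :
    ∑ i, (∑ j, u j * V i j) * conj (∑ j, v j * V i j) = δ * ∑ j, u j * conj (v j) := by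
  have h1 : ∀ j j', ∑ i, conj (V i j') * V i j = δ * if j' = j then 1 else 0 := by
    intro j j'
    have := congrFun (congrFun hV j') j
    simpa [Matrix.mul_apply, Matrix.one_apply] using this
  calc ∑ i, (∑ j, u j * V i j) * conj (∑ j, v j * V i j)
      = ∑ i, ∑ j, ∑ j', u j * conj (v j') * (conj (V i j') * V i j) := by
        simp only [map_sum, map_mul, Finset.sum_mul_sum]
        refine Finset.sum_congr rfl fun i _ => Finset.sum_congr rfl fun j _ =>
          Finset.sum_congr rfl fun j' _ => by ring
    _ = ∑ j, ∑ j', u j * conj (v j') * ∑ i, conj (V i j') * V i j := by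
        simp only [Finset.mul_sum]
        rw [Finset.sum_comm]
        exact Finset.sum_congr rfl fun j _ => Finset.sum_comm
    _ = _ := by
        simp only [h1, mul_ite, mul_one, mul_zero, Finset.sum_ite_eq', Finset.mem_univ, if_true,
          Finset.mul_sum]
        exact Finset.sum_congr rfl fun j _ => by ring

theorem flat_of_isometry {m k : Type*} [Fintype m] [Fintype k] [DecidableEq k]
    {R : Matrix m k ℂ} {δ : ℂ} (hR : Rᴴ * R = δ • 1) (c : ℂ) :
    (c • (R * Rᴴ)) * (c • (R * Rᴴ)) = (c * δ) • (c • (R * Rᴴ)) := by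
  rw [Matrix.smul_mul, Matrix.mul_smul, Matrix.mul_assoc, ← Matrix.mul_assoc Rᴴ, hR,
    Matrix.smul_mul, Matrix.mul_smul, Matrix.one_mul, smul_smul, smul_smul, smul_smul]
  congr 1
  ring

theorem trace_of_isometry {m k : Type*} [Fintype m] [Fintype k] [DecidableEq k]
    {R : Matrix m k ℂ} {δ : ℂ} (hR : Rᴴ * R = δ • 1) (c : ℂ) :
    (c • (R * Rᴴ)).trace = c * δ * Fintype.card k := by
  rw [Matrix.trace_smul, Matrix.trace_mul_comm, hR, Matrix.trace_smul, Matrix.trace_one]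
  simp [mul_assoc]

/-- The amplitude of two parties sharing a maximally entangled pair: contraction of the second leg
of `A` with the first leg of `B`. -/
def glue [Fintype Q] (A : Matrix m (Q × Q) ℂ) (B : Matrix n (Q × Q) ℂ) : Matrix (m × n) (Q × Q) ℂ :=
  fun p q => ∑ y, A p.1 (q.1, y) * B p.2 (y, q.2)

theorem glue_isometry [Fintype m] [Fintype n] [Fintype Q] [DecidableEq Q]
    (hA : Aᴴ * A = α • 1) (hB : Bᴴ * B = β • 1) :
    (glue A B)ᴴ * glue A B = (α * β * Fintype.card Q) • 1 := by
  have hA' : ∀ q q', ∑ a, conj (A a q) * A a q' = if q = q' then α else 0 := by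
    intro q q'
    have := congrFun (congrFun hA q) q'
    simpa [Matrix.mul_apply, Matrix.one_apply] using this
  have hB' : ∀ q q', ∑ a, conj (B a q) * B a q' = if q = q' then β else 0 := by
    intro q q'
    have := congrFun (congrFun hB q) q'
    simpa [Matrix.mul_apply, Matrix.one_apply] using this
  ext ⟨x, z⟩ ⟨x', z'⟩
  have h : ((glue A B)ᴴ * glue A B) (x, z) (x', z')
      = ∑ y, ∑ y', (∑ a, conj (A a (x, y)) * A a (x', y'))
        * ∑ b, conj (B b (y, z)) * B b (y', z') := by
    simp only [Matrix.mul_apply, Matrix.conjTranspose_apply, glue, ← starRingEnd_apply, map_sum,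
      map_mul, Finset.sum_mul_sum, Fintype.sum_prod_type]
    rw [Finset.sum_congr rfl fun a _ => Finset.sum_comm, Finset.sum_comm]
    refine Finset.sum_congr rfl fun y _ => ?_
    rw [Finset.sum_congr rfl fun a _ => Finset.sum_comm, Finset.sum_comm]
    refine Finset.sum_congr rfl fun y' _ => Finset.sum_congr rfl fun a _ =>
      Finset.sum_congr rfl fun b _ => by ring
  rw [h]
  simp only [hA', hB', Prod.mk.injEq, ite_and, mul_ite, ite_mul, zero_mul, mul_zero,
    Matrix.smul_apply, Matrix.one_apply, smul_eq_mul, mul_one]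
  by_cases hx : x = x' <;> by_cases hz : z = z' <;> simp [hx, hz, mul_comm, mul_assoc]

/-- Exchange of the two middle legs. -/
def swapMid : (Q × Q) × (Q × Q) ≃ (Q × Q) × (Q × Q) where
  toFun q := ((q.1.1, q.2.1), (q.1.2, q.2.2))
  invFun q := ((q.1.1, q.2.1), (q.1.2, q.2.2))
  left_inv _ := rfl
  right_inv _ := rfl

/-- The permutation matrix of `swapMid`. -/
def swapMatrix (Q : Type*) [DecidableEq Q] : Matrix ((Q × Q) × (Q × Q)) ((Q × Q) × (Q × Q)) ℂ :=
  (1 : Matrix _ _ ℂ).submatrix swapMid id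

theorem swapMatrix_apply [DecidableEq Q] (p q : (Q × Q) × (Q × Q)) :
    swapMatrix Q p q = if swapMid p = q then 1 else 0 := by
  simp [swapMatrix, Matrix.one_apply]

theorem swapMatrix_mul_self [Fintype Q] [DecidableEq Q] : swapMatrix Q * swapMatrix Q = 1 := by
  ext p q
  simp only [Matrix.mul_apply, swapMatrix_apply, ite_mul, one_mul, zero_mul, Finset.sum_ite_eq,
    Finset.mem_univ, if_true, Matrix.one_apply]
  rfl

theorem trace_swapMatrix [Fintype Q] [DecidableEq Q] :
    (swapMatrix Q).trace = (Fintype.card Q : ℂ) ^ 3 := by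
  have : ∀ p : (Q × Q) × (Q × Q), swapMid p = p ↔ p.2.1 = p.1.2 := by
    rintro ⟨⟨x, y⟩, ⟨y', z⟩⟩
    simp [swapMid, eq_comm]
  have h : ∀ y : Q, ∑ y' : Q, ∑ _z : Q, (if y' = y then (1 : ℂ) else 0) = Fintype.card Q := by
    intro y
    rw [Finset.sum_eq_single y (fun y' _ hy' => by simp [hy']) (by simp)]
    simp
  simp only [Matrix.trace, Matrix.diag_apply, swapMatrix_apply, this, Fintype.sum_prod_type, h]
  simp only [Finset.sum_const, Finset.card_univ, nsmul_eq_mul]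
  ring

/-- The state of three parties each two of which share a maximally entangled pair, on which the
parties act locally by `A`, `B` and `C`. -/
def triangle [Fintype Q] (A : Matrix m (Q × Q) ℂ) (B : Matrix n (Q × Q) ℂ) (C : Matrix l (Q × Q) ℂ)
    (a : m) (b : n) (c : l) : ℂ :=
  ∑ x, ∑ y, ∑ z, A a (x, y) * B b (y, z) * C c (z, x)

theorem submatrix_swap_isometry [Fintype l] [DecidableEq Q] (hC : Cᴴ * C = γ • 1) :
    (C.submatrix id Prod.swap)ᴴ * C.submatrix id Prod.swap = γ • 1 := by
  have h := congrArg (fun M : Matrix (Q × Q) (Q × Q) ℂ =>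
    M.submatrix (Equiv.prodComm Q Q) (Equiv.prodComm Q Q)) hC
  simp only [Matrix.submatrix_smul, Pi.smul_apply, Matrix.submatrix_one_equiv] at h
  rw [← h, Matrix.conjTranspose_submatrix]
  rfl

theorem triangle_eq_glue [Fintype Q] (a : m) (b : n) (c : l) :
    triangle A B C a b c = ∑ j, glue A B (a, b) j * C.submatrix id Prod.swap c j := by
  simp only [triangle, glue, Fintype.sum_prod_type, Matrix.submatrix_apply, id, Prod.swap,
    Finset.sum_mul]
  exact Finset.sum_congr rfl fun x _ => Finset.sum_comm

theorem triangle_rotate [Fintype Q] (a : m) (b : n) (c : l) :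
    triangle A B C a b c = triangle B C A b c a := by
  simp only [triangle]
  rw [Finset.sum_comm]
  refine Finset.sum_congr rfl fun y _ => ?_
  rw [Finset.sum_comm]
  refine Finset.sum_congr rfl fun z _ => Finset.sum_congr rfl fun x _ => by ring

theorem triangle_eq_mul_glue [Fintype Q] (a : m) (b : n) (c : l) :
    triangle A B C a b c = ∑ j, A a j * (glue B C).submatrix id Prod.swap (b, c) j := by
  rw [triangle_rotate, triangle_eq_glue, ← (Equiv.prodComm Q Q).sum_comp]
  exact Finset.sum_congr rfl fun j _ => mul_comm _ _

theorem sum_triangle_last [Fintype l] [Fintype Q] [DecidableEq Q] (hC : Cᴴ * C = γ • 1)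
    (p q : m × n) :
    ∑ c, triangle A B C p.1 p.2 c * conj (triangle A B C q.1 q.2 c)
      = (γ • (glue A B * (glue A B)ᴴ)) p q := by
  simp only [triangle_eq_glue]
  rw [sum_conj_mul_of_isometry (submatrix_swap_isometry hC)]
  rfl

theorem sum_triangle_last_two [Fintype l] [Fintype n] [Fintype Q] [DecidableEq Q]
    (hB : Bᴴ * B = β • 1) (hC : Cᴴ * C = γ • 1) (a a' : m) :
    ∑ p : n × l, triangle A B C a p.1 p.2 * conj (triangle A B C a' p.1 p.2)
      = ((β * γ * Fintype.card Q) • (A * Aᴴ)) a a' := by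
  simp only [triangle_eq_mul_glue]
  rw [sum_conj_mul_of_isometry (submatrix_swap_isometry (glue_isometry hB hC))]
  rfl

theorem kronecker_isometry [Fintype m] [Fintype n] [DecidableEq Q]
    (hA : Aᴴ * A = α • 1) (hB : Bᴴ * B = β • 1) (hβ : conj β = β) :
    (A ⊗ₖ B.map conj)ᴴ * (A ⊗ₖ B.map conj) = (α * β) • 1 := by
  have hB' : (B.map conj)ᴴ * B.map conj = β • 1 := by
    ext q q'
    have h := congrArg conj (congrFun (congrFun hB q) q')
    simp only [Matrix.mul_apply, Matrix.conjTranspose_apply, Matrix.map_apply, map_sum, map_mul,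
      Matrix.smul_apply, Matrix.one_apply, smul_eq_mul, hβ, apply_ite (starRingEnd ℂ), map_one,
      map_zero, ← starRingEnd_apply] at h ⊢
    exact h
  rw [Matrix.conjTranspose_kronecker, ← Matrix.mul_kronecker_mul, hA, hB', Matrix.smul_kronecker,
    Matrix.kronecker_smul, Matrix.one_kronecker_one, smul_smul]

/-- Partial transposition turns the shared maximally entangled pair into a swap operator. -/
theorem partialTranspose_glue [Fintype Q] [DecidableEq Q] (p q : m × n) :
    partialTranspose (γ • (glue A B * (glue A B)ᴴ)) p q
      = (γ • (A ⊗ₖ B.map conj * swapMatrix Q * (A ⊗ₖ B.map conj)ᴴ)) p q := by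
  have h : ∀ (W : Matrix (m × n) ((Q × Q) × (Q × Q)) ℂ) r, (W * swapMatrix Q) p r
      = W p (swapMid r) := by
    intro W r
    have : ∀ s : (Q × Q) × (Q × Q), swapMid s = r ↔ s = swapMid r := fun s =>
      ⟨fun h => by rw [← h]; rfl, fun h => by rw [h]; rfl⟩
    simp [Matrix.mul_apply, swapMatrix_apply, this]
  simp only [partialTranspose, Matrix.smul_apply, smul_eq_mul]
  congr 1
  rw [Matrix.mul_apply, Matrix.mul_apply]
  simp only [h, Matrix.conjTranspose_apply, glue, Fintype.sum_prod_type,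
    ← starRingEnd_apply, map_sum, map_mul, Finset.sum_mul_sum, swapMid, Equiv.coe_fn_mk]
  refine Finset.sum_congr rfl fun x _ => ?_
  rw [Finset.sum_comm]
  conv_rhs => rw [Finset.sum_comm]
  refine Finset.sum_congr rfl fun y _ => ?_
  rw [Finset.sum_comm]
  refine Finset.sum_congr rfl fun y' _ => Finset.sum_congr rfl fun z _ => ?_
  rw [Matrix.kronecker_apply, Matrix.kronecker_apply, Matrix.map_apply, Matrix.map_apply, map_mul,
    Complex.conj_conj]
  ring

theorem swap_conjugate_cube [Fintype Q] [DecidableEq Q] {k : Type*} [Fintype k]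
    {W : Matrix k ((Q × Q) × (Q × Q)) ℂ} {δ : ℂ}
    (hW : Wᴴ * W = δ • 1) (c : ℂ) :
    let X := c • (W * swapMatrix Q * Wᴴ)
    X * X * X = (c * δ) ^ 2 • X ∧ X.trace = c * δ * Fintype.card Q ^ 3 ∧
      (X * X).trace = (c * δ) ^ 2 * Fintype.card Q ^ 4 := by
  intro X
  have h2 : X * X = (c ^ 2 * δ) • (W * Wᴴ) := by
    calc X * X = (c * c) • (W * (swapMatrix Q * (Wᴴ * W) * swapMatrix Q) * Wᴴ) := by
          simp only [X, Matrix.smul_mul, Matrix.mul_smul, smul_smul, Matrix.mul_assoc]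
      _ = _ := by
          rw [hW, Matrix.mul_smul, Matrix.mul_one, Matrix.smul_mul, swapMatrix_mul_self,
            Matrix.mul_smul, Matrix.mul_one, Matrix.smul_mul, smul_smul]
          congr 1
          ring
  refine ⟨?_, ?_, ?_⟩
  · calc X * X * X = (c ^ 2 * δ * c) • (W * (Wᴴ * W) * swapMatrix Q * Wᴴ) := by
          rw [h2]
          simp only [X, Matrix.smul_mul, Matrix.mul_smul, smul_smul, Matrix.mul_assoc, mul_comm c]
      _ = _ := by
          rw [hW, Matrix.mul_smul, Matrix.mul_one, Matrix.smul_mul, Matrix.smul_mul, smul_smul,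
            smul_smul]
          congr 1
          ring
  · rw [Matrix.trace_smul, Matrix.trace_mul_comm, ← Matrix.mul_assoc, hW, Matrix.smul_mul,
      Matrix.one_mul, Matrix.trace_smul, trace_swapMatrix, smul_eq_mul, smul_eq_mul, mul_assoc]
  · rw [h2, Matrix.trace_smul, Matrix.trace_mul_comm, hW, Matrix.trace_smul, Matrix.trace_one]
    simp only [smul_eq_mul, Fintype.card_prod]
    push_cast
    ring

end Triangle

end

noncomputable section

open scoped Kronecker

variable {LA LB LC t : ℕ}

/-! ### The evolved state as a triangle state -/

/-- The block amplitude `F` with the coupling across the left cut absorbed into it: the first leg is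
now the history of the last site of the preceding block. -/
def dressedAmplitude {m : Type*} (F : Matrix m (Config t × Config t) ℂ) :
    Matrix m (Config t × Config t) ℂ :=
  F * (hadamard t ⊗ₖ (1 : Op t))

theorem dressedAmplitude_apply {m : Type*} (F : Matrix m (Config t × Config t) ℂ) (a : m)
    (x y : Config t) : dressedAmplitude F a (x, y) = ∑ l, F a (l, y) * kickSign l x := by
  simp [dressedAmplitude, Matrix.mul_apply, Matrix.one_apply, hadamard, Fintype.sum_prod_type]

theorem dressedAmplitude_isometry {m : Type*} [Fintype m] {F : Matrix m (Config t × Config t) ℂ}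
    {c : ℂ} (hF : Fᴴ * F = c • 1) :
    (dressedAmplitude F)ᴴ * dressedAmplitude F = (c * 2 ^ t) • 1 := by
  have hH : (hadamard t)ᴴ = hadamard t := by
    ext x y
    rw [Matrix.conjTranspose_apply, hadamard, ← starRingEnd_apply, conj_kickSign, kickSign_comm]
    rfl
  rw [dressedAmplitude, Matrix.conjTranspose_mul, Matrix.mul_assoc, ← Matrix.mul_assoc Fᴴ, hF,
    Matrix.smul_mul, Matrix.one_mul, Matrix.mul_smul, Matrix.conjTranspose_kronecker,
    ← Matrix.mul_kronecker_mul, hH, hadamard_mul_self, Matrix.conjTranspose_one, Matrix.one_mul,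
    Matrix.smul_kronecker, Matrix.one_kronecker_one, smul_smul]

theorem triangle_dressedAmplitude {l m n : Type*} (F : Matrix m (Config t × Config t) ℂ)
    (G : Matrix n (Config t × Config t) ℂ) (H : Matrix l (Config t × Config t) ℂ) (a : m) (b : n)
    (c : l) :
    triangle (dressedAmplitude F) (dressedAmplitude G) (dressedAmplitude H) a b c
      = ∑ lA, ∑ rA, F a (lA, rA) * ∑ lB, ∑ rB, G b (lB, rB) * ∑ lC, ∑ rC, H c (lC, rC)
        * (kickSign rA lB * kickSign rB lC * kickSign rC lA) := by
  have hcomm : ∀ g : Config t → Config t → Config t → Config t → Config t → Config t → ℂ,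
      ∑ lA, ∑ rA, ∑ lB, ∑ rB, ∑ lC, ∑ rC, g lA rA lB rB lC rC
        = ∑ rC, ∑ rA, ∑ rB, ∑ lA, ∑ lB, ∑ lC, g lA rA lB rB lC rC := by
    intro g
    let e : Config t × Config t × Config t × Config t × Config t × Config t
        ≃ Config t × Config t × Config t × Config t × Config t × Config t :=
      { toFun := fun p => (p.2.2.2.2.2, p.2.1, p.2.2.2.1, p.1, p.2.2.1, p.2.2.2.2.1)
        invFun := fun q => (q.2.2.2.1, q.2.1, q.2.2.2.2.1, q.2.2.1, q.2.2.2.2.2, q.1)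
        left_inv := fun _ => rfl
        right_inv := fun _ => rfl }
    have h := Fintype.sum_equiv e
      (fun p => g p.1 p.2.1 p.2.2.1 p.2.2.2.1 p.2.2.2.2.1 p.2.2.2.2.2)
      (fun q => g q.2.2.2.1 q.2.1 q.2.2.2.2.1 q.2.2.1 q.2.2.2.2.2 q.1) (fun _ => rfl)
    simpa only [Fintype.sum_prod_type] using h
  simp only [Finset.mul_sum]
  rw [hcomm]
  simp only [triangle, dressedAmplitude_apply, Finset.sum_mul]
  refine Finset.sum_congr rfl fun x _ => Finset.sum_congr rfl fun y _ =>
    Finset.sum_congr rfl fun z _ => Finset.sum_congr rfl fun lA _ => ?_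
  rw [Finset.mul_sum]
  conv_rhs => rw [Finset.sum_comm]
  refine Finset.sum_congr rfl fun lC _ => ?_
  rw [Finset.mul_sum, Finset.sum_mul]
  refine Finset.sum_congr rfl fun lB _ => ?_
  rw [kickSign_comm y, kickSign_comm z, kickSign_comm x]
  ring

/-- Up to local isometries the evolved state consists of three maximally entangled pairs of local
dimension `2 ^ t`, one for each cut. -/
theorem evolved_eq_triangle (hA : 2 * t ≤ LA) (hB : 2 * t ≤ LB) (hC : 2 * t ≤ LC)
    (h : Fin (LA + LB + LC) → ℝ) {ψ₀ : Config (LA + LB + LC) → ℂ}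
    (hψ₀ : ψ₀ ∈ transverseClass (LA + LB + LC)) :
    ∃ (A : Matrix (Config LA) (Config t × Config t) ℂ)
      (B : Matrix (Config LB) (Config t × Config t) ℂ)
      (C : Matrix (Config LC) (Config t × Config t) ℂ) (α β γ : ℝ),
      Aᴴ * A = (α : ℂ) • 1 ∧ Bᴴ * B = (β : ℂ) • 1 ∧ Cᴴ * C = (γ : ℂ) • 1 ∧
      ∀ a b c, evolved (Real.pi / 4) (-(Real.pi / 4)) h ψ₀ t (join a b c)
        = triangle A B C a b c := by
  obtain ⟨N, f, hf, hN⟩ := evolved_eq_sum h hψ₀ t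
  obtain ⟨cA, hcA⟩ := blockAmplitude_isometry hA
    (f := fun τ k => f τ (Fin.castAdd LC (Fin.castAdd LB k))) (fun _ _ _ => hf _ _ _)
  obtain ⟨cB, hcB⟩ := blockAmplitude_isometry hB
    (f := fun τ k => f τ (Fin.castAdd LC (Fin.natAdd LA k))) (fun _ _ _ => hf _ _ _)
  obtain ⟨cC, hcC⟩ := blockAmplitude_isometry hC
    (f := fun τ k => f τ (Fin.natAdd (LA + LB) k)) (fun _ _ _ => hf _ _ _)
  refine ⟨N • dressedAmplitude
      (blockAmplitude fun τ k => f τ (Fin.castAdd LC (Fin.castAdd LB k))),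
    dressedAmplitude (blockAmplitude fun τ k => f τ (Fin.castAdd LC (Fin.natAdd LA k))),
    dressedAmplitude (blockAmplitude fun τ k => f τ (Fin.natAdd (LA + LB) k)),
    ‖N‖ ^ 2 * (cA * 2 ^ t), cB * 2 ^ t, cC * 2 ^ t, ?_, ?_, ?_, fun a b c => ?_⟩
  · rw [Matrix.conjTranspose_smul, Matrix.smul_mul, Matrix.mul_smul,
      dressedAmplitude_isometry hcA, smul_smul, smul_smul, ← starRingEnd_apply]
    congr 1
    push_cast
    rw [← Complex.conj_mul']
  · rw [dressedAmplitude_isometry hcB]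
    push_cast
    rfl
  · rw [dressedAmplitude_isometry hcC]
    push_cast
    rfl
  · rw [hN, sum_ringWeight_join hA hB hC, ← triangle_dressedAmplitude]
    simp only [triangle, Matrix.smul_apply, smul_eq_mul, Finset.mul_sum, mul_assoc]

/-! ### Reduced density matrices -/

theorem rhoA_isHermitian (ψ : Config (LA + LB + LC) → ℂ) : (rhoA ψ).IsHermitian := by
  ext a a'
  rw [Matrix.conjTranspose_apply, rhoA, star_sum]
  exact Finset.sum_congr rfl fun b _ => (rhoAB_isHermitian ψ).apply _ _

theorem rhoB_isHermitian (ψ : Config (LA + LB + LC) → ℂ) : (rhoB ψ).IsHermitian := by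
  ext b b'
  rw [Matrix.conjTranspose_apply, rhoB, star_sum]
  exact Finset.sum_congr rfl fun a _ => (rhoAB_isHermitian ψ).apply _ _

theorem trace_rhoAB (ψ : Config (LA + LB + LC) → ℂ) :
    (rhoAB ψ).trace = ∑ x, ψ x * conj (ψ x) := by
  rw [sum_join, Matrix.trace, Fintype.sum_prod_type]
  rfl

section

variable {ψ : Config (LA + LB + LC) → ℂ} {A : Matrix (Config LA) (Config t × Config t) ℂ}
  {B : Matrix (Config LB) (Config t × Config t) ℂ} {C : Matrix (Config LC) (Config t × Config t) ℂ}
  {α β γ : ℂ}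

theorem rhoAB_eq (hC : Cᴴ * C = γ • 1) (hψ : ∀ a b c, ψ (join a b c) = triangle A B C a b c) :
    rhoAB ψ = γ • (glue A B * (glue A B)ᴴ) := by
  ext p q
  rw [← sum_triangle_last hC]
  simp only [rhoAB, hψ]

theorem rhoA_eq (hB : Bᴴ * B = β • 1) (hC : Cᴴ * C = γ • 1)
    (hψ : ∀ a b c, ψ (join a b c) = triangle A B C a b c) :
    rhoA ψ = (β * γ * Fintype.card (Config t)) • (A * Aᴴ) := by
  ext a a'
  rw [← sum_triangle_last_two hB hC, Fintype.sum_prod_type]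
  simp only [rhoA, rhoAB, hψ]

theorem rhoB_eq (hA : Aᴴ * A = α • 1) (hC : Cᴴ * C = γ • 1)
    (hψ : ∀ a b c, ψ (join a b c) = triangle A B C a b c) :
    rhoB ψ = (γ * α * Fintype.card (Config t)) • (B * Bᴴ) := by
  ext b b'
  rw [← sum_triangle_last_two hC hA, Fintype.sum_prod_type_right]
  simp only [rhoB, rhoAB, hψ, triangle_rotate (A := A)]

end

/-- A normalised triangle state has a flat entanglement spectrum, and the partial transpose of its
two-party density matrix is up to normalisation and a local isometry a swap operator. -/
theorem spectrum_of_triangle {ψ : Config (LA + LB + LC) → ℂ}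
    {A : Matrix (Config LA) (Config t × Config t) ℂ}
    {B : Matrix (Config LB) (Config t × Config t) ℂ}
    {C : Matrix (Config LC) (Config t × Config t) ℂ}
    {α β γ : ℝ} (hA : Aᴴ * A = (α : ℂ) • 1) (hB : Bᴴ * B = (β : ℂ) • 1)
    (hC : Cᴴ * C = (γ : ℂ) • 1) (hψ : ∀ a b c, ψ (join a b c) = triangle A B C a b c)
    (hnorm : ∑ x, ψ x * conj (ψ x) = 1) :
    (rhoABTB ψ * rhoABTB ψ * rhoABTB ψ = (((1 / 2 : ℝ) ^ (3 * t) : ℝ) : ℂ) ^ 2 • rhoABTB ψ ∧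
      (rhoABTB ψ).trace.re = (1 / 2 : ℝ) ^ (3 * t) * 2 ^ (3 * t) ∧
      (rhoABTB ψ * rhoABTB ψ).trace.re = ((1 / 2 : ℝ) ^ (3 * t)) ^ 2 * 2 ^ (4 * t)) ∧
    ∀ s : ℝ, renyiEntropy s (rhoAB ψ) = -Real.log ((1 / 2 : ℝ) ^ (2 * t)) ∧
      renyiEntropy s (rhoA ψ) = -Real.log ((1 / 2 : ℝ) ^ (2 * t)) ∧
      renyiEntropy s (rhoB ψ) = -Real.log ((1 / 2 : ℝ) ^ (2 * t)) := by
  have hcard : (Fintype.card (Config t) : ℂ) = 2 ^ t := by simp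
  have hcard2 : (Fintype.card (Config t × Config t) : ℂ) = 2 ^ t * 2 ^ t := by simp
  have hAB := rhoAB_eq hC hψ
  have hglue := glue_isometry hA hB
  have h2 : (2 : ℂ) ^ t ≠ 0 := pow_ne_zero _ two_ne_zero
  -- the trace condition fixes the product of the three normalisations
  have hαβγ : (α * β * γ : ℂ) * (2 ^ t) ^ 3 = 1 := by
    rw [← hnorm, ← trace_rhoAB, hAB, trace_of_isometry hglue, hcard, hcard2]
    ring
  have hμ : (((1 / 2 : ℝ) ^ (3 * t) : ℝ) : ℂ) = γ * (α * β) := by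
    apply mul_right_cancel₀ (pow_ne_zero 3 h2)
    rw [show (γ * (α * β) : ℂ) = α * β * γ by ring, hαβγ, ← pow_mul, mul_comm t 3]
    push_cast
    rw [← mul_pow]
    norm_num
  have hν : (((1 / 2 : ℝ) ^ (2 * t) : ℝ) : ℂ) = α * β * γ * 2 ^ t := by
    apply mul_right_cancel₀ (pow_ne_zero 2 h2)
    rw [show (α * β * γ * 2 ^ t * (2 ^ t) ^ 2 : ℂ) = α * β * γ * (2 ^ t) ^ 3 by ring, hαβγ,
      ← pow_mul, mul_comm t 2]
    push_cast
    rw [← mul_pow]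
    norm_num
  have hνpos : (0 : ℝ) < (1 / 2) ^ (2 * t) := by positivity
  refine ⟨?_, fun s => ⟨?_, ?_, ?_⟩⟩
  · have hX : rhoABTB ψ
        = (γ : ℂ) • (A ⊗ₖ B.map conj * swapMatrix (Config t) * (A ⊗ₖ B.map conj)ᴴ) := by
      ext p q
      rw [rhoABTB, hAB, partialTranspose_glue]
    obtain ⟨h3, h1, h2'⟩ := swap_conjugate_cube
      (kronecker_isometry hA hB (Complex.conj_ofReal β)) (γ : ℂ)
    rw [← hX, ← hμ] at h3 h1 h2'
    refine ⟨h3, ?_, ?_⟩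
    · rw [h1, hcard, ← pow_mul, mul_comm t 3]
      norm_cast
    · rw [h2', hcard, ← pow_mul, mul_comm t 4]
      norm_cast
  · refine renyiEntropy_of_mul_self (rhoAB_isHermitian ψ) hνpos ?_
      ((trace_rhoAB ψ).trans hnorm) s
    rw [hν, hAB, flat_of_isometry hglue, hcard]
    congr 1
    ring
  · have hρ := rhoA_eq hB hC hψ
    refine renyiEntropy_of_mul_self (rhoA_isHermitian ψ) hνpos ?_ ?_ s
    · rw [hν, hρ, flat_of_isometry hA, hcard]
      congr 1
      ring
    · rw [hρ, trace_of_isometry hA, hcard, hcard2, ← hαβγ]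
      ring
  · have hρ := rhoB_eq hA hC hψ
    refine renyiEntropy_of_mul_self (rhoB_isHermitian ψ) hνpos ?_ ?_ s
    · rw [hν, hρ, flat_of_isometry hB, hcard]
      congr 1
      ring
    · rw [hρ, trace_of_isometry hB, hcard, hcard2, ← hαβγ]
      ring

end

end KickedIsing

theorem theorem1 (LA LB LC t : ℕ) (hA : 2 * t ≤ LA) (hB : 2 * t ≤ LB) (hC : 2 * t ≤ LC)
    (h : Fin (LA + LB + LC) → ℝ) (ψ₀ : KickedIsing.Config (LA + LB + LC) → ℂ)
    (hψ₀ : ψ₀ ∈ KickedIsing.transverseClass (LA + LB + LC))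
    (ψ : KickedIsing.Config (LA + LB + LC) → ℂ)
    (hψ : ψ = KickedIsing.evolved (Real.pi / 4) (-(Real.pi / 4)) h ψ₀ t) :
    ((∀ i, (Matrix.toEuclideanLin (KickedIsing.rhoABTB ψ)).singularValues i ≠ 0 →
        (Matrix.toEuclideanLin (KickedIsing.rhoABTB ψ)).singularValues i
          = (1 / 2 : ℝ) ^ (3 * t)) ∧
      (Matrix.toEuclideanLin (KickedIsing.rhoABTB ψ)).singularValues.support.card
        = 2 ^ (4 * t)) ∧
    (KickedIsing.numPos (KickedIsing.rhoABTB_isHermitian ψ) : ℝ)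
      = ((2 : ℝ) ^ (4 * t) + 2 ^ (3 * t)) / 2 ∧
    (KickedIsing.numNeg (KickedIsing.rhoABTB_isHermitian ψ) : ℝ)
      = ((2 : ℝ) ^ (4 * t) - 2 ^ (3 * t)) / 2 ∧
    KickedIsing.negativity (KickedIsing.rhoABTB ψ) = t * Real.log 2 ∧
    KickedIsing.oddEntropy (KickedIsing.rhoABTB_isHermitian ψ) = 3 * t * Real.log 2 ∧
    ∀ α : ℝ, 0 ≤ α →
      2 * KickedIsing.negativity (KickedIsing.rhoABTB ψ)
        = 2 / 3 * KickedIsing.oddEntropy (KickedIsing.rhoABTB_isHermitian ψ) ∧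
      2 / 3 * KickedIsing.oddEntropy (KickedIsing.rhoABTB_isHermitian ψ)
        = KickedIsing.renyiMutualInfo α ψ ∧
      KickedIsing.renyiMutualInfo α ψ = KickedIsing.renyiEntropy α (KickedIsing.rhoA ψ) ∧
      KickedIsing.renyiEntropy α (KickedIsing.rhoA ψ)
        = KickedIsing.renyiEntropy α (KickedIsing.rhoB ψ) := by
  obtain ⟨A, B, C, α, β, γ, hA', hB', hC', htri⟩ := KickedIsing.evolved_eq_triangle hA hB hC h hψ₀
  have hnorm := KickedIsing.sum_conj_mul_evolved (Real.pi / 4) (-(Real.pi / 4)) h hψ₀ t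
  rw [← hψ] at htri hnorm
  obtain ⟨⟨h3, h1, h2⟩, hS⟩ := KickedIsing.spectrum_of_triangle hA' hB' hC' htri hnorm
  have hX := KickedIsing.rhoABTB_isHermitian ψ
  have hμ : (0 : ℝ) < (1 / 2) ^ (3 * t) := by positivity
  obtain ⟨hpos, hneg⟩ := KickedIsing.numPos_numNeg_of_traces hX hμ h3 h1 h2
  have hsum : (KickedIsing.numPos hX : ℝ) + KickedIsing.numNeg hX = 2 ^ (4 * t) := by
    rw [hpos, hneg]; ring
  have hdiff : (KickedIsing.numPos hX : ℝ) - KickedIsing.numNeg hX = 2 ^ (3 * t) := by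
    rw [hpos, hneg]; ring
  have hunit : (2 : ℝ) ^ (3 * t) * (1 / 2) ^ (3 * t) = 1 := by
    rw [← mul_pow]; norm_num
  have hE : KickedIsing.negativity (KickedIsing.rhoABTB ψ) = t * Real.log 2 := by
    rw [KickedIsing.negativity_eq hX hμ h3, hsum, show 4 * t = t + 3 * t by ring, pow_add,
      mul_assoc, hunit, mul_one, Real.log_pow]
  have hO : KickedIsing.oddEntropy hX = 3 * t * Real.log 2 := by
    rw [KickedIsing.oddEntropy_eq hX hμ h3, hdiff, hunit, one_mul, Real.log_pow, one_div,
      Real.log_inv]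
    push_cast
    ring
  have hν : -Real.log ((1 / 2 : ℝ) ^ (2 * t)) = 2 * (t * Real.log 2) := by
    rw [Real.log_pow, one_div, Real.log_inv]
    push_cast
    ring
  rw [hν] at hS
  refine ⟨⟨KickedIsing.singularValues_eq hX hμ h3, ?_⟩, hpos, hneg, hE, hO, fun s _ => ?_⟩
  · rw [KickedIsing.card_support_singularValues_eq hX]
    exact_mod_cast hsum
  · obtain ⟨hSAB, hSA, hSB⟩ := hS s
    rw [KickedIsing.renyiMutualInfo, hSAB, hSA, hSB, hE, hO]
    refine ⟨?_, ?_, ?_, rfl⟩ <;> ring
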